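/- Let $d\ge 2$, let $X\subseteq\mathbb R^d$ be closed and convex, let $\zeta$ be a random element with law $P$, and let $F(\cdot,\zeta)$ be everywhere differentiable for each value of $\zeta$. Suppose that $f(x)=\mathbb E[F(x,\zeta)]$ is finite for every $x\in\mathbb R^d$ and everywhere differentiable, and that $\mathbb E[\nabla F(x,\zeta)]=\nabla f(x)$ for $x\in X$. Assume that for some $\sigma_\infty>0$, $L>0$, $\underline f\in\mathbb R$ and all $x,y\in X$: $$\mathbb E\|\nabla F(x,\zeta)-\nabla f(x)\|_\infty^2\le\sigma_\infty^2,\qquad \mathbb E\|\nabla F(x,\zeta)-\nabla F(y,\zeta)\|_\infty^2\le L^2\|x-y\|_1^2,\qquad f(x)\ge\underline f .$$ Algorithm. Start from a (possibly random) $x^1\in X$ with $f(x^1)$ integrable. For $k=1,\dots,K$ let $n_k=\lfloor (k-1)/q\rfloor q+1$, draw $m_k$ fresh samples $\zeta^k_1,\dots,\zeta^k_{m_k}$ of $\zeta$, where $m_k=m_1$ if $k=n_k$ and $m_k=m$ otherwise, and set $$G^k=\begin{cases}\frac1{m_k}\sum_{i=1}^{m_k}\nabla F(x^k,\zeta^k_i),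 & k=n_k,\\[2pt] \frac1{m_k}\sum_{i=1}^{m_k}\big(\nabla F(x^k,\zeta^k_i)-\nabla F(x^{k-1},\zeta^k_i)\big)+G^{k-1}, & k\ne n_k,\end{cases}$$ $$x^{k+1}=\operatorname*{arg\,min}\Big\{\tfrac12\|x-(x^k-\eta G^k)\|_2^2 \;:\; x\in X,\ \|x-x^k\|_1\le\psi\Big\}.$$ All samples are i.i.d. and independent of $x^1$. The output is $x^{Y+1}$, with $Y$ uniform on $\{1,\dots,K\}$ and independent of $x^1$ and of the samples. Let $\Delta_f=\mathbb E[f(x^1)]-\underline f>0$, $\Omega=e^2\log d$, $\varepsilon>0$, let $c\ge e^2$ be a constant (for instance $c=e^2$), and take $$\eta=\frac1L,\qquad \psi=\frac{\varepsilon}{L},\qquad K=\Big\lceil\frac{\Delta_f L}{\varepsilon^2}\Big\rceil,\qquad m_1=\Big\lceil\frac{\Omega\, c\,(\log d)\,\sigma_\infty^2}{\varepsilon^2}\Big\rceil,$$ and let $q$ and $m$ be positive integers obtained by rounding, up or down, the positive reals $\bar q$, $\bar m$ determined by $\bar m=\Omega^2\bar q$ and $\bar m\,\bar q=m_1$ (that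 is, $|q-\bar q|<1$ and $|m-\bar m|<1$). Then there is an absolute constant $C$ (independent of $c$, of the problem data and of the parameters) such that, for every $\varepsilon>0$, $$\mathbb E\big[\operatorname{dist}_{\|\cdot\|_\infty}\big(0,\partial(f+\delta_X)(x^{Y+1})\big)\big]\le C\varepsilon ,$$ where $\delta_X$ is the indicator function of $X$ ($0$ on $X$, $+\infty$ elsewhere) and $\partial$ is the subdifferential. The number of samples drawn, $\sum_{k=1}^K m_k$, is $$O\!\left(\frac{\Delta_f L\,\Omega^2\sigma_\infty}{\varepsilon^3}\right)$$ for small $\varepsilon$: there is a constant $C'$ depending only on $c$ such that $\sum_{k=1}^K m_k\le C'\,\Delta_f L\,\Omega^2\sigma_\infty/\varepsilon^3$ whenever $\varepsilon\le\Omega\sigma_\infty$, $\varepsilon^2\le\Delta_f L$ and $\varepsilon\,\sigma_\infty\le\Delta_f L$. -/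

import Mathlib

open MeasureTheory ProbabilityTheory Topology
open scoped ENNReal RealInnerProductSpace

noncomputable section

namespace DISFOM

/-- `ℝ^d` with its Euclidean structure, so that `gradient` is the vector of partial derivatives. -/
abbrev Vec (d : ℕ) := EuclideanSpace ℝ (Fin d)

/-- The norm `‖x‖₁ = ∑ i, |x i|`. -/
def l1Norm {d : ℕ} (x : Vec d) : ℝ := ∑ i, |x i|

/-- The norm `‖x‖_∞ = max i, |x i|` (the norm of `Fin d → ℝ` is the sup norm). -/
def linfNorm {d : ℕ} (x : Vec d) : ℝ := ‖(fun i => x i : Fin d → ℝ)‖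

/-- The constant `Ω = e² log d`. -/
def Omega (d : ℕ) : ℝ := Real.exp 2 * Real.log d

/-! ### Residual -/

open Classical in
/-- The convex indicator function `δ_A`: `0` on `A` and `+∞` off `A`. -/
def indicatorFn {d : ℕ} (A : Set (Vec d)) (x : Vec d) : EReal := if x ∈ A then 0 else ⊤

/-- The (Fréchet) subdifferential of an extended-real-valued function `h` at a point `x` where `h`
is finite: the vectors `v` with `h y ≥ h x + ⟪v, y - x⟫ - o(‖y - x‖)` as `y → x`. -/
def subdifferential {d : ℕ} (h : Vec d → EReal) (x : Vec d) : Set (Vec d) :=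
  {v | h x ≠ ⊤ ∧ h x ≠ ⊥ ∧ ∀ δ : ℝ, 0 < δ → ∀ᶠ y in 𝓝 x,
    h x + ((⟪v, y - x⟫ - δ * ‖y - x‖ : ℝ) : EReal) ≤ h y}

/-- The residual `dist_{‖·‖_∞}(0, ∂(f + δ_X)(x))`, an infimum in `[0, ∞]`. -/
def residual {d : ℕ} (f : Vec d → ℝ) (X : Set (Vec d)) (x : Vec d) : ℝ≥0∞ :=
  ⨅ v ∈ subdifferential (fun y => (f y : EReal) + indicatorFn X y) x, ENNReal.ofReal (linfNorm v)

/-! ### The stochastic optimization problem -/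

section Problem

variable {d : ℕ} {Ξ : Type*}

/-- The objective `f(x) = 𝔼[F(x, ζ)]`. -/
def objective [MeasurableSpace Ξ] (P : Measure Ξ) (F : Vec d → Ξ → ℝ) (x : Vec d) : ℝ :=
  ∫ z, F x z ∂P

/-- The stochastic gradient `∇F(x, z)`, gradient in `x`. -/
def stochGrad (F : Vec d → Ξ → ℝ) (x : Vec d) (z : Ξ) : Vec d := gradient (fun y => F y z) x

/-- The standing assumptions: `X` is closed and convex, `F(x, ζ)` is a random variable with finite
expectation for every `x`, `F(·, z)` and `f` are everywhere differentiable, and `∇F(x, ζ)` is an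
unbiased estimate of `∇f(x)` for every `x ∈ X`. -/
structure IsAdmissible [MeasurableSpace Ξ] (P : Measure Ξ) (X : Set (Vec d))
    (F : Vec d → Ξ → ℝ) : Prop where
  isClosed : IsClosed X
  convex : Convex ℝ X
  measurable : ∀ x, Measurable (F x)
  integrable : ∀ x, Integrable (F x) P
  differentiable : ∀ z, Differentiable ℝ (fun x => F x z)
  differentiable_objective : Differentiable ℝ (objective P F)
  integrable_grad : ∀ x ∈ X, Integrable (stochGrad F x) P
  unbiased : ∀ x ∈ X, ∫ z, stochGrad F x z ∂P = gradient (objective P F) x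

/-- Bounded variance: `𝔼 ‖∇F(x, ζ) - ∇f(x)‖_∞² ≤ σ²` for all `x ∈ X`. -/
def BoundedVariance [MeasurableSpace Ξ] (P : Measure Ξ) (X : Set (Vec d)) (F : Vec d → Ξ → ℝ)
    (σ : ℝ) : Prop :=
  ∀ x ∈ X,
    Integrable (fun z => linfNorm (stochGrad F x z - gradient (objective P F) x) ^ 2) P ∧
    ∫ z, linfNorm (stochGrad F x z - gradient (objective P F) x) ^ 2 ∂P ≤ σ ^ 2

/-- Mean-squared Lipschitz smoothness:
`𝔼 ‖∇F(x, ζ) - ∇F(y, ζ)‖_∞² ≤ L² ‖x - y‖₁²` for all `x, y ∈ X`. -/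
def MeanSquaredSmooth [MeasurableSpace Ξ] (P : Measure Ξ) (X : Set (Vec d)) (F : Vec d → Ξ → ℝ)
    (L : ℝ) : Prop :=
  ∀ x ∈ X, ∀ y ∈ X,
    Integrable (fun z => linfNorm (stochGrad F x z - stochGrad F y z) ^ 2) P ∧
    ∫ z, linfNorm (stochGrad F x z - stochGrad F y z) ^ 2 ∂P ≤ L ^ 2 * l1Norm (x - y) ^ 2

end Problem

/-! ### The algorithm -/

section Algorithm

/-- The proximal projection: `x'` minimizes `(1/2) ‖x - v‖² + φ(x - xk)` over `x ∈ X`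
(here `‖·‖` is the Euclidean norm). -/
def IsProxProj {d : ℕ} (X : Set (Vec d)) (φ : Vec d → EReal) (xk v x' : Vec d) : Prop :=
  x' ∈ X ∧ ∀ x ∈ X,
    ((1 / 2 * ‖x' - v‖ ^ 2 : ℝ) : EReal) + φ (x' - xk) ≤
      ((1 / 2 * ‖x - v‖ ^ 2 : ℝ) : EReal) + φ (x - xk)

/-- The `ℓ₁`-ball of radius `ψ` centred at the origin. -/
def l1Ball (d : ℕ) (ψ : ℝ) : Set (Vec d) := {z | l1Norm z ≤ ψ}

/-- The index `n_k = ⌊(k - 1) / q⌋ q + 1` of the last large batch, for `k ≥ 1`. -/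
def refreshIndex (q k : ℕ) : ℕ := (k - 1) / q * q + 1

/-- The batch size: `m₁` at the iterations `k = n_k` (that is, `k ≡ 1` modulo `q`), and `m` at the
other ones. -/
def batchSize (q m₁ m k : ℕ) : ℕ := if k = refreshIndex q k then m₁ else m

/-- The variance-reduced estimate `G^k`, `k ≥ 1`, along the iterates `x` with samples `z k i`,
`i < batchSize q m₁ m k`. The value at `0` is never used, since `1` is a large-batch iteration. -/
def spiderEstimate {d : ℕ} {Ξ : Type*} (F : Vec d → Ξ → ℝ) (q m₁ m : ℕ) (x : ℕ → Vec d)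
    (z : ℕ → ℕ → Ξ) : ℕ → Vec d
  | 0 => 0
  | k + 1 =>
    if k + 1 = refreshIndex q (k + 1) then
      ((batchSize q m₁ m (k + 1) : ℝ)⁻¹) •
        ∑ i ∈ Finset.range (batchSize q m₁ m (k + 1)), stochGrad F (x (k + 1)) (z (k + 1) i)
    else
      ((batchSize q m₁ m (k + 1) : ℝ)⁻¹) •
          (∑ i ∈ Finset.range (batchSize q m₁ m (k + 1)), stochGrad F (x (k + 1)) (z (k + 1) i) -
            ∑ i ∈ Finset.range (batchSize q m₁ m (k + 1)), stochGrad F (x k) (z (k + 1) i)) +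
        spiderEstimate F q m₁ m x z k

/-- `x 1, …, x (K + 1)` are the iterates of the variance-reduced method with step size `η` and
proximal term `φ = δ_{‖·‖₁ ≤ ψ}`, run for `K` iterations on the samples `z`. -/
structure IsRun {d : ℕ} {Ξ : Type*} (X : Set (Vec d)) (F : Vec d → Ξ → ℝ) (η ψ : ℝ)
    (q m₁ m K : ℕ) (z : ℕ → ℕ → Ξ) (x : ℕ → Vec d) : Prop where
  init_mem : x 1 ∈ X
  step : ∀ k, 1 ≤ k → k ≤ K →
    IsProxProj X (indicatorFn (l1Ball d ψ)) (x k) (x k - η • spiderEstimate F q m₁ m x z k)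
      (x (k + 1))

/-- The number of samples drawn in `K` iterations. -/
def sampleCount (q m₁ m K : ℕ) : ℕ := ∑ k ∈ Finset.Icc 1 K, batchSize q m₁ m k

/-- The randomness of the method: the samples `ζ k i` are i.i.d. with law `P`, the starting point
`x₁` is independent of the samples, and `Y` is uniform on `{1, …, K}` and independent of the
starting point and the samples. -/
structure IsSampling {d : ℕ} {Ξ S : Type*} [MeasurableSpace Ξ] [MeasurableSpace S] (P : Measure Ξ)
    (μ : Measure S) (K : ℕ) (x₁ : S → Vec d) (ζ : ℕ → ℕ → S → Ξ) (Y : S → ℕ) : Prop where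
  measurable_init : Measurable x₁
  measurable_sample : ∀ k i, Measurable (ζ k i)
  measurable_index : Measurable Y
  law_sample : ∀ k i, μ.map (ζ k i) = P
  indep_samples : iIndepFun (fun p : ℕ × ℕ => ζ p.1 p.2) μ
  indep_init : IndepFun x₁ (fun s k i => ζ k i s) μ
  uniform_index : ∀ k ∈ Finset.Icc 1 K, μ {s | Y s = k} = (K : ℝ≥0∞)⁻¹
  indep_index : IndepFun Y (fun s => (x₁ s, fun k i => ζ k i s)) μ

/-- `n` is a positive integer obtained by rounding the real number `r` up or down (`n = r` when `r`
is itself a positive integer). -/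
def IsRounding (r : ℝ) (n : ℕ) : Prop := 1 ≤ n ∧ |(n : ℝ) - r| < 1

end Algorithm

end DISFOM

end

namespace DISFOM

variable {d : ℕ}

/-! ### The norms -/

section Norms

/-! Write e_k = ‖G^k - ∇f(x^k)‖_∞. The argument combines a deterministic estimate for one proximal
step with a bound 𝔼 e_k ≤ 3ε that costs only logarithmic factors of the dimension.

One step (`residual_proxProj_le`). Put s = x^{k+1} - x^k and a = s + G^k/L. The optimality condition
has a multiplier w for the ℓ₁ constraint (`exists_multiplier`): -(a + w) is normal to X at x^{k+1}
and w is normal to the ball at s. Hence v = ∇f(x^{k+1}) - L(a + w) is a subgradient, and all its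
parts except L w are of size ε or e_k. By duality of the norms, (ε/L)‖w‖_∞ ≤ ⟪w, s⟫; optimality
tested at x^k gives ⟪w, s⟫ ≤ -⟪G^k, s⟫/L, and the descent inequality turns this into a decrease of
f. The residual is therefore at most 3ε + 2e_k + (L/ε)(f(x^k) - f(x^{k+1})). Averaging over k
telescopes the last term to at most ε, since K ≥ Δ_f L/ε²; the total is (3 + 2·3 + 1)ε.

Gradient error (`lintegral_softmax_error_le`). The square of the sup norm is not smooth, so the
error is measured by Φ(x) = β⁻¹ log ∑ cosh(β x_i), which exceeds ‖x‖_∞ up to log 2/β, equals log d/β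
at 0, and satisfies Φ(x + y) ≤ Φ(x) + ⟪w, y⟫ + (β/2)‖y‖_∞² (`exists_softmax_add_le`, from
Hoeffding's lemma). Feeding in samples one at a time, the linear term averages to zero because each
sample is independent of the past. A large batch contributes (β/2)σ²/m₁ and a small one at most
(β/2)4ε²/m, because consecutive iterates are within ε/L in ℓ₁. With β = log d/ε and fewer than q
small batches between large ones, everything is O(ε) (`error_bound_le`).

Sample count. The total is at most ⌈K/q⌉ m₁ + K m, and the choice m̄ q̄ = m₁ balances the two terms
at order K m̄, where m̄ = Ω √m₁. -/

lemma abs_apply_le_linfNorm (x : Vec d) (i : Fin d) : |x i| ≤ linfNorm x :=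
  norm_le_pi_norm (fun i => x i : Fin d → ℝ) i

lemma linfNorm_nonneg (x : Vec d) : 0 ≤ linfNorm x := norm_nonneg _

lemma linfNorm_le {x : Vec d} {r : ℝ} (hr : 0 ≤ r) (h : ∀ i, |x i| ≤ r) : linfNorm x ≤ r :=
  (pi_norm_le_iff_of_nonneg hr).2 h

lemma linfNorm_sub_le (x y : Vec d) : linfNorm (x - y) ≤ linfNorm x + linfNorm y :=
  norm_sub_le (fun i => x i : Fin d → ℝ) (fun i => y i)

lemma linfNorm_smul (c : ℝ) (x : Vec d) : linfNorm (c • x) = |c| * linfNorm x :=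
  norm_smul c (fun i => x i : Fin d → ℝ)

lemma continuous_linfNorm : Continuous (linfNorm : Vec d → ℝ) := by
  unfold linfNorm
  fun_prop

lemma continuous_l1Norm : Continuous (l1Norm : Vec d → ℝ) := by
  unfold l1Norm
  fun_prop

lemma l1Norm_nonneg (x : Vec d) : 0 ≤ l1Norm x := Finset.sum_nonneg fun _ _ => abs_nonneg _

lemma l1Norm_smul (c : ℝ) (x : Vec d) : l1Norm (c • x) = |c| * l1Norm x := by
  simp [l1Norm, abs_mul, Finset.mul_sum]

lemma l1Norm_add_le (x y : Vec d) : l1Norm (x + y) ≤ l1Norm x + l1Norm y := by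
  simp only [l1Norm, ← Finset.sum_add_distrib]
  exact Finset.sum_le_sum fun i _ => abs_add_le _ _

lemma l1Norm_zero : l1Norm (0 : Vec d) = 0 := by simp [l1Norm]

lemma linfNorm_le_l1Norm (x : Vec d) : linfNorm x ≤ l1Norm x :=
  linfNorm_le (l1Norm_nonneg x) fun i =>
    Finset.single_le_sum (f := fun i => |x i|) (fun _ _ => abs_nonneg _) (Finset.mem_univ i)

lemma inner_eq_sum (x y : Vec d) : ⟪x, y⟫ = ∑ i, x i * y i := by
  simp [PiLp.inner_apply, mul_comm]

lemma abs_inner_le (x y : Vec d) : |⟪x, y⟫| ≤ linfNorm x * l1Norm y := by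
  rw [inner_eq_sum, l1Norm, Finset.mul_sum]
  refine (Finset.abs_sum_le_sum_abs _ _).trans (Finset.sum_le_sum fun i _ => ?_)
  rw [abs_mul]
  exact mul_le_mul_of_nonneg_right (abs_apply_le_linfNorm x i) (abs_nonneg _)

lemma norm_le_l1Norm (x : Vec d) : ‖x‖ ≤ l1Norm x := by
  have h1 := abs_inner_le x x
  rw [real_inner_self_eq_norm_sq, abs_of_nonneg (sq_nonneg _)] at h1
  have h2 := mul_le_mul_of_nonneg_right (linfNorm_le_l1Norm x) (l1Norm_nonneg x)
  exact (sq_le_sq₀ (norm_nonneg x) (l1Norm_nonneg x)).1 (by linarith)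

/-- The `ℓ_∞`-norm is dual to the `ℓ₁`-norm. -/
lemma mul_linfNorm_le_of_inner_le {w : Vec d} {ψ r : ℝ} (hψ : 0 ≤ ψ) (hr : 0 ≤ r)
    (h : ∀ b : Vec d, l1Norm b ≤ ψ → ⟪w, b⟫ ≤ r) : ψ * linfNorm w ≤ r := by
  have key : ∀ i, ψ * |w i| ≤ r := by
    intro i
    have h1 : ∀ t : ℝ, |t| = ψ → t * w i ≤ r := by
      intro t ht
      -- The extreme points ±ψ e_i of the ℓ₁-ball suffice as test vectors.
      have := h (EuclideanSpace.single i t) (by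
        rw [l1Norm, Finset.sum_eq_single i] <;> simp +contextual [ht])
      rwa [EuclideanSpace.inner_single_right, conj_trivial] at this
    rcases abs_cases (w i) with hc | hc
    · rw [hc.1]; exact h1 ψ (abs_of_nonneg hψ)
    · rw [hc.1]
      have := h1 (-ψ) (by rw [abs_neg, abs_of_nonneg hψ])
      linarith
  rcases hψ.eq_or_lt with rfl | hψ
  · simpa
  · rw [← le_div_iff₀' hψ]
    exact linfNorm_le (by positivity) fun i => (le_div_iff₀' hψ).2 (key i)

end Norms

/-! ### Hoeffding's lemma and the smoothness of the soft maximum -/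

section Softmax

/-- Hoeffding's lemma for a finite probability vector. -/
lemma sum_mul_exp_le_of_abs_le {ι : Type*} [Fintype ι] {p v : ι → ℝ} {M : ℝ}
    (hp : ∀ i, 0 ≤ p i) (hp1 : ∑ i, p i = 1) (hv : ∀ i, |v i| ≤ M) :
    ∑ i, p i * Real.exp (v i) ≤ Real.exp (∑ i, p i * v i + M ^ 2 / 2) := by
  let _ : MeasurableSpace ι := ⊤
  set μ : Measure ι := ∑ i, ENNReal.ofReal (p i) • Measure.dirac i with hμ
  have hint : ∀ g : ι → ℝ, ∫ x, g x ∂μ = ∑ i, p i * g i := by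
    intro g
    rw [hμ, integral_finsetSum_measure]
    · refine Finset.sum_congr rfl fun i _ => ?_
      rw [integral_smul_measure, integral_dirac, ENNReal.toReal_ofReal (hp i), smul_eq_mul]
    · intro i _
      exact (integrable_dirac (by simp)).smul_measure ENNReal.ofReal_ne_top
  have : IsProbabilityMeasure μ := ⟨by
    simp only [hμ, Measure.coe_finsetSum, Finset.sum_apply, Measure.smul_apply,
      measure_univ, smul_eq_mul, mul_one]
    rw [← ENNReal.ofReal_sum_of_nonneg fun i _ => hp i, hp1, ENNReal.ofReal_one]⟩
  -- An interval of length 2M gives variance proxy (2M/2)² = M²; the moment generating function of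
  -- the centred variable is used at 1.
  have h := (hasSubgaussianMGF_of_mem_Icc (μ := μ) (X := v) (a := -M) (b := M)
    (measurable_from_top.aemeasurable)
    (Filter.Eventually.of_forall fun i => abs_le.1 (hv i))).mgf_le 1
  simp only [mgf, hint, one_mul, one_pow, mul_one] at h
  have hM : ((‖M - -M‖₊ / 2) ^ 2 : NNReal) = M ^ 2 := by
    push_cast
    rw [Real.norm_eq_abs, div_pow, sq_abs]; ring
  rw [hM] at h
  set s := ∑ i, p i * v i
  calc ∑ i, p i * Real.exp (v i) = Real.exp s * ∑ i, p i * Real.exp (v i - s) := by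
        rw [Finset.mul_sum]
        refine Finset.sum_congr rfl fun i _ => ?_
        rw [Real.exp_sub]; field_simp
    _ ≤ Real.exp s * Real.exp (M ^ 2 / 2) := by gcongr
    _ = _ := by rw [← Real.exp_add]

/-- The sum `∑ i, cosh (x i)`. -/
noncomputable def sumCosh (x : Vec d) : ℝ := ∑ i, Real.cosh (x i)

lemma natCast_le_sumCosh (x : Vec d) : (d : ℝ) ≤ sumCosh x := by
  have : ∑ _i : Fin d, (1 : ℝ) ≤ sumCosh x := Finset.sum_le_sum fun i _ => Real.one_le_cosh _
  simpa using this

lemma sumCosh_pos [NeZero d] (x : Vec d) : 0 < sumCosh x :=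
  lt_of_lt_of_le (by exact_mod_cast Nat.pos_of_ne_zero (NeZero.ne d)) (natCast_le_sumCosh x)

/-- The ratio of the two sums is an expectation of exp(±y_i) under the Gibbs weights exp(±x_i)/(2Z)
on signed coordinates. Hoeffding's lemma applies with range ‖y‖_∞, and the mean of ±y_i is the
linear term. The quadratic constant is free of d. -/
lemma log_sumCosh_add_le [NeZero d] (x y : Vec d) :
    Real.log (sumCosh (x + y)) ≤ Real.log (sumCosh x) +
      ∑ i, Real.sinh (x i) / sumCosh x * y i + linfNorm y ^ 2 / 2 := by
  have hZ := sumCosh_pos x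
  have h := sum_mul_exp_le_of_abs_le (ι := Fin d ⊕ Fin d) (M := linfNorm y)
    (p := Sum.elim (fun i => Real.exp (x i) / (2 * sumCosh x))
      (fun i => Real.exp (-x i) / (2 * sumCosh x)))
    (v := Sum.elim (fun i => y i) (fun i => -y i))
    (by rintro (i | i) <;> simp only [Sum.elim_inl, Sum.elim_inr] <;> positivity)
    (by
      simp only [Fintype.sum_sum_type, Sum.elim_inl, Sum.elim_inr, ← Finset.sum_div, ← add_div,
        ← Finset.sum_add_distrib]
      rw [div_eq_one_iff_eq (by positivity), sumCosh, Finset.mul_sum]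
      refine Finset.sum_congr rfl fun i _ => ?_
      rw [Real.cosh_eq]; ring)
    (by rintro (i | i) <;> simp [abs_apply_le_linfNorm])
  simp only [Fintype.sum_sum_type, Sum.elim_inl, Sum.elim_inr, ← Finset.sum_add_distrib] at h
  have h1 : ∑ i, (Real.exp (x i) / (2 * sumCosh x) * Real.exp (y i) +
      Real.exp (-x i) / (2 * sumCosh x) * Real.exp (-y i)) = sumCosh (x + y) / sumCosh x := by
    rw [show sumCosh (x + y) = ∑ i, Real.cosh ((x + y) i) from rfl, Finset.sum_div]
    refine Finset.sum_congr rfl fun i _ => ?_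
    rw [PiLp.add_apply, Real.cosh_eq, neg_add, Real.exp_add, Real.exp_add]
    field_simp
  have h2 : ∑ i, (Real.exp (x i) / (2 * sumCosh x) * y i +
      Real.exp (-x i) / (2 * sumCosh x) * -y i) = ∑ i, Real.sinh (x i) / sumCosh x * y i := by
    refine Finset.sum_congr rfl fun i _ => ?_
    rw [Real.sinh_eq]
    field_simp
    ring
  rw [h1, h2] at h
  have h3 := Real.log_le_log (div_pos (sumCosh_pos (x + y)) hZ) h
  rw [Real.log_div (sumCosh_pos _).ne' hZ.ne', Real.log_exp] at h3
  linarith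

/-- The soft maximum `β⁻¹ log ∑ i, cosh (β x i)` of the absolute values of the coordinates. -/
noncomputable def softmax (β : ℝ) (x : Vec d) : ℝ := β⁻¹ * Real.log (sumCosh (β • x))

lemma continuous_softmax [NeZero d] (β : ℝ) : Continuous (softmax β : Vec d → ℝ) := by
  have h : Continuous (fun x : Vec d => sumCosh (β • x)) := by
    unfold sumCosh
    fun_prop
  exact (h.log fun x => (sumCosh_pos _).ne').const_mul _

lemma softmax_nonneg [NeZero d] {β : ℝ} (hβ : 0 < β) (x : Vec d) : 0 ≤ softmax β x := by
  refine mul_nonneg (inv_nonneg.2 hβ.le) (Real.log_nonneg ?_)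
  refine le_trans ?_ (natCast_le_sumCosh _)
  exact_mod_cast Nat.pos_of_ne_zero (NeZero.ne d)

lemma softmax_zero (β : ℝ) : softmax β (0 : Vec d) = Real.log d / β := by
  simp [softmax, sumCosh, div_eq_inv_mul]

/-- One summand already satisfies cosh t ≥ exp|t|/2; the factor 1/2 is the source of log 2/β. -/
lemma linfNorm_le_softmax [NeZero d] {β : ℝ} (hβ : 0 < β) (x : Vec d) :
    linfNorm x ≤ softmax β x + Real.log 2 / β := by
  refine linfNorm_le (add_nonneg (softmax_nonneg hβ x)
    (div_nonneg (Real.log_nonneg (by norm_num)) hβ.le)) fun i => ?_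
  have h1 : Real.exp (β * |x i|) / 2 ≤ sumCosh (β • x) := by
    calc Real.exp (β * |x i|) / 2 ≤ Real.cosh (β * |x i|) := by
          rw [Real.cosh_eq]
          have := Real.exp_pos (-(β * |x i|))
          linarith
      _ = Real.cosh ((β • x) i) := by
          rw [PiLp.smul_apply, smul_eq_mul, ← Real.cosh_abs (β * x i), abs_mul, abs_of_pos hβ]
      _ ≤ _ := Finset.single_le_sum (f := fun i => Real.cosh ((β • x) i))
          (fun j _ => (Real.cosh_pos _).le) (Finset.mem_univ i)
  have h2 := Real.log_le_log (by positivity) h1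
  rw [Real.log_div (Real.exp_pos _).ne' two_ne_zero, Real.log_exp] at h2
  rw [softmax, ← div_eq_inv_mul, ← add_div, le_div_iff₀ hβ]
  linarith

/-- The vector w is the gradient of the soft maximum, but only its independence of y matters: the
linear term vanishes in expectation for centred y. -/
lemma exists_softmax_add_le [NeZero d] {β : ℝ} (hβ : 0 < β) (x : Vec d) :
    ∃ w : Vec d, ∀ y : Vec d,
      softmax β (x + y) ≤ softmax β x + ⟪w, y⟫ + β / 2 * linfNorm y ^ 2 := by
  refine ⟨WithLp.toLp 2 fun i => Real.sinh ((β • x) i) / sumCosh (β • x), fun y => ?_⟩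
  have h := log_sumCosh_add_le (β • x) (β • y)
  rw [← smul_add] at h
  have h' := mul_le_mul_of_nonneg_left h (inv_nonneg.2 hβ.le)
  refine h'.trans_eq ?_
  rw [inner_eq_sum, linfNorm_smul, mul_add, mul_add, softmax, Finset.mul_sum, abs_of_pos hβ]
  congr 1
  · congr 1
    refine Finset.sum_congr rfl fun i _ => ?_
    simp only [PiLp.smul_apply, smul_eq_mul]
    field_simp
  · field_simp

end Softmax

/-! ### The subdifferential and the residual -/

section Residual

variable {f : Vec d → ℝ} {X : Set (Vec d)} {x : Vec d}

lemma inner_gradient_eq_fderiv (f : Vec d → ℝ) (x y : Vec d) :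
    ⟪gradient f x, y⟫ = fderiv ℝ f x y :=
  InnerProductSpace.toDual_symm_apply

lemma eventually_abs_sub_inner_gradient_le (hf : DifferentiableAt ℝ f x) {δ : ℝ} (hδ : 0 < δ) :
    ∀ᶠ y in 𝓝 x, |f y - f x - ⟪gradient f x, y - x⟫| ≤ δ * ‖y - x‖ := by
  filter_upwards [hf.hasFDerivAt.isLittleO.def hδ] with y hy
  rwa [← inner_gradient_eq_fderiv] at hy

lemma subdifferential_of_notMem (hx : x ∉ X) :
    subdifferential (fun y => (f y : EReal) + indicatorFn X y) x = ∅ := by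
  ext v
  simp [subdifferential, indicatorFn, hx]

/-- The subdifferential of `f + δ_X` is the gradient of `f` plus the normal cone of `X`. -/
lemma mem_subdifferential_iff (hX : Convex ℝ X) (hf : DifferentiableAt ℝ f x) (hx : x ∈ X)
    {v : Vec d} :
    v ∈ subdifferential (fun y => (f y : EReal) + indicatorFn X y) x ↔
      ∀ z ∈ X, ⟪v - gradient f x, z - x⟫ ≤ 0 := by
  constructor
  · rintro ⟨-, -, h⟩ z hz
    refine le_of_forall_pos_le_add fun r hr => ?_
    -- Both inequalities are tested at x + t(z - x) and divided by t. One δ is paid for the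
    -- subgradient inequality, one for the differentiability of f.
    obtain ⟨δ, hδ, hδr⟩ : ∃ δ > 0, 2 * δ * ‖z - x‖ ≤ r := by
      refine ⟨r / (2 * (‖z - x‖ + 1)), by positivity, ?_⟩
      rw [mul_div_assoc', div_mul_eq_mul_div, div_le_iff₀ (by positivity)]
      nlinarith [norm_nonneg (z - x)]
    have ht : Filter.Tendsto (fun t : ℝ => x + t • (z - x)) (𝓝[>] 0) (𝓝 x) := by
      have : ContinuousAt (fun t : ℝ => x + t • (z - x)) 0 := by fun_prop
      simpa [ContinuousAt] using this.tendsto.mono_left nhdsWithin_le_nhds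
    have hev := (ht.eventually ((h δ hδ).and (eventually_abs_sub_inner_gradient_le hf hδ))).and
      (Ioo_mem_nhdsGT (show (0 : ℝ) < 1 by norm_num))
    obtain ⟨t, ⟨h1, h2⟩, ht0, ht1⟩ := hev.exists
    have hy : x + t • (z - x) ∈ X := hX.add_smul_sub_mem hx hz ⟨ht0.le, ht1.le⟩
    simp only [indicatorFn, hx, hy, if_true, add_zero, add_sub_cancel_left] at h1 h2
    rw [← EReal.coe_add, EReal.coe_le_coe_iff, inner_smul_right] at h1
    rw [inner_smul_right] at h2
    rw [norm_smul, Real.norm_eq_abs, abs_of_pos ht0] at h1 h2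
    have h3 := (abs_le.1 h2).2
    rw [inner_sub_left, zero_add]
    have h4 : t * (⟪v, z - x⟫ - ⟪gradient f x, z - x⟫) ≤ t * r := by nlinarith
    exact le_of_mul_le_mul_left h4 ht0
  · intro h
    refine ⟨by simp [indicatorFn, hx], by simp [indicatorFn, hx], fun δ hδ => ?_⟩
    filter_upwards [eventually_abs_sub_inner_gradient_le hf hδ] with y hy
    by_cases hyX : y ∈ X
    · simp only [indicatorFn, hx, hyX, if_true, add_zero]
      rw [← EReal.coe_add, EReal.coe_le_coe_iff]
      have h1 := h y hyX
      rw [inner_sub_left] at h1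
      have h2 := (abs_le.1 hy).1
      linarith
    · simp [indicatorFn, hyX]

lemma residual_le (hX : Convex ℝ X) (hf : DifferentiableAt ℝ f x) (hx : x ∈ X) {v : Vec d}
    (hv : ∀ z ∈ X, ⟪v - gradient f x, z - x⟫ ≤ 0) :
    residual f X x ≤ ENNReal.ofReal (linfNorm v) :=
  iInf₂_le v ((mem_subdifferential_iff hX hf hx).2 hv)

lemma norm_le_mul_linfNorm (v : Vec d) : ‖v‖ ≤ d * linfNorm v := by
  refine (norm_le_l1Norm v).trans ?_
  calc l1Norm v ≤ ∑ _i : Fin d, linfNorm v :=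
        Finset.sum_le_sum fun i _ => abs_apply_le_linfNorm v i
    _ = _ := by simp

/-- The residual is lower semicontinuous: near-optimal subgradients along a convergent sequence are
bounded, and a cluster point is a subgradient at the limit because the normal cone inequality passes
to the limit. -/
lemma measurable_residual (hXc : IsClosed X) (hX : Convex ℝ X) (hf : Differentiable ℝ f)
    (hg : ContinuousOn (gradient f) X) : Measurable (residual f X) := by
  refine measurable_of_Iic fun r => ?_
  by_cases hr : r = ⊤
  · simp [hr]
  refine IsClosed.measurableSet (IsSeqClosed.isClosed fun u x hu hux => ?_)
  -- The slack 1/(n+1) avoids showing that the infimum is attained.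
  have hv : ∀ n, u n ∈ X ∧ ∃ v : Vec d, (∀ z ∈ X, ⟪v - gradient f (u n), z - u n⟫ ≤ 0) ∧
      linfNorm v ≤ r.toReal + 1 / ((n : ℝ) + 1) := by
    intro n
    have hpos : (0 : ℝ) < 1 / ((n : ℝ) + 1) := by positivity
    have hlt : residual f X (u n) < r + ENNReal.ofReal (1 / ((n : ℝ) + 1)) :=
      lt_of_le_of_lt (hu n) (ENNReal.lt_add_right hr (by simpa using hpos))
    simp only [residual, iInf_lt_iff] at hlt
    obtain ⟨v, hv, hvr⟩ := hlt
    have hmem : u n ∈ X := by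
      by_contra hn
      rw [subdifferential_of_notMem hn] at hv
      exact hv
    refine ⟨hmem, v, (mem_subdifferential_iff hX (hf _) hmem).1 hv, ?_⟩
    rw [← ENNReal.ofReal_toReal hr, ← ENNReal.ofReal_add ENNReal.toReal_nonneg hpos.le] at hvr
    exact (ENNReal.ofReal_lt_ofReal_iff_of_nonneg (linfNorm_nonneg v)).1 hvr |>.le
  choose hmem v hv hvr using hv
  have hx : x ∈ X := hXc.isSeqClosed hmem hux
  have hb : Bornology.IsBounded (Set.range v) := by
    refine (Metric.isBounded_iff_subset_closedBall 0).2 ⟨d * (r.toReal + 1), ?_⟩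
    rintro _ ⟨n, rfl⟩
    rw [mem_closedBall_zero_iff]
    refine (norm_le_mul_linfNorm _).trans (mul_le_mul_of_nonneg_left ((hvr n).trans ?_) (by simp))
    have : 1 / ((n : ℝ) + 1) ≤ 1 := by
      rw [div_le_one (by positivity)]
      have : (0 : ℝ) ≤ n := by positivity
      linarith
    linarith
  obtain ⟨w, -, φ, hφ, hw⟩ := tendsto_subseq_of_bounded hb fun n => Set.mem_range_self n
  have huφ := hux.comp hφ.tendsto_atTop
  have hgu : Filter.Tendsto (fun n => gradient f (u (φ n))) Filter.atTop (𝓝 (gradient f x)) :=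
    (hg x hx).tendsto.comp (tendsto_nhdsWithin_iff.2
      ⟨huφ, Filter.Eventually.of_forall fun n => hmem _⟩)
  have hwsub : ∀ z ∈ X, ⟪w - gradient f x, z - x⟫ ≤ 0 := fun z hz =>
    le_of_tendsto' ((hw.sub hgu).inner (tendsto_const_nhds.sub huφ)) fun n => hv (φ n) z hz
  have hwr : linfNorm w ≤ r.toReal := by
    have h1 : Filter.Tendsto (fun n => r.toReal + 1 / ((φ n : ℝ) + 1)) Filter.atTop
        (𝓝 (r.toReal + 0)) :=
      (tendsto_one_div_add_atTop_nhds_zero_nat.comp hφ.tendsto_atTop).const_add _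
    rw [add_zero] at h1
    exact le_of_tendsto_of_tendsto' ((continuous_linfNorm.tendsto w).comp hw) h1
      fun n => hvr (φ n)
  exact (residual_le hX (hf x) hx hwsub).trans (ENNReal.ofReal_le_of_le_toReal hwr)

end Residual

/-! ### The proximal step -/

section Prox

variable {X : Set (Vec d)} {ψ : ℝ} {xk v x' : Vec d}

/-- The centre is feasible with a finite value, so a minimizer cannot have value +∞ and the
indicator becomes a genuine constraint. -/
lemma isProxProj_indicatorFn_iff (hxk : xk ∈ X) (hψ : 0 ≤ ψ) :
    IsProxProj X (indicatorFn (l1Ball d ψ)) xk v x' ↔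
      x' ∈ X ∧ l1Norm (x' - xk) ≤ ψ ∧
        ∀ x ∈ X, l1Norm (x - xk) ≤ ψ → ‖x' - v‖ ≤ ‖x - v‖ := by
  have hle : ∀ x : Vec d, (1 / 2 * ‖x' - v‖ ^ 2 ≤ 1 / 2 * ‖x - v‖ ^ 2 ↔ ‖x' - v‖ ≤ ‖x - v‖) := by
    intro x
    rw [mul_le_mul_iff_right₀ (by norm_num), sq_le_sq₀ (norm_nonneg _) (norm_nonneg _)]
  constructor
  · rintro ⟨hx', h⟩
    have hmem : l1Norm (x' - xk) ≤ ψ := by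
      by_contra hn
      have := h xk hxk
      simp only [indicatorFn, l1Ball, Set.mem_ofPred_eq, hn, sub_self, l1Norm_zero, hψ, if_true,
        if_false, EReal.coe_add_top, add_zero, top_le_iff] at this
      exact EReal.coe_ne_top _ this
    refine ⟨hx', hmem, fun x hx hxψ => (hle x).1 ?_⟩
    have := h x hx
    simp only [indicatorFn, l1Ball, Set.mem_ofPred_eq, hmem, hxψ, if_true, add_zero,
      EReal.coe_le_coe_iff] at this
    exact this
  · rintro ⟨hx', hmem, h⟩
    refine ⟨hx', fun x hx => ?_⟩
    by_cases hxψ : l1Norm (x - xk) ≤ ψ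
    · simp only [indicatorFn, l1Ball, Set.mem_ofPred_eq, hmem, hxψ, if_true, add_zero,
        EReal.coe_le_coe_iff]
      exact (hle x).2 (h x hx hxψ)
    · simp only [indicatorFn, l1Ball, Set.mem_ofPred_eq, hxψ, if_false, EReal.coe_add_top, le_top]

lemma convex_l1Norm_sub_le (y : Vec d) (ψ : ℝ) : Convex ℝ {x : Vec d | l1Norm (x - y) ≤ ψ} := by
  intro a ha b hb s t hs ht hst
  have : s • a + t • b - y = s • (a - y) + t • (b - y) := by
    have : y = s • y + t • y := by rw [← add_smul, hst, one_smul]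
    nth_rewrite 1 [this]
    module
  rw [Set.mem_ofPred_eq, this]
  refine (l1Norm_add_le _ _).trans ?_
  rw [l1Norm_smul, l1Norm_smul, abs_of_nonneg hs, abs_of_nonneg ht]
  calc s * l1Norm (a - y) + t * l1Norm (b - y) ≤ s * ψ + t * ψ :=
        add_le_add (mul_le_mul_of_nonneg_left ha hs) (mul_le_mul_of_nonneg_left hb ht)
    _ = ψ := by rw [← add_mul, hst, one_mul]

/-- The variational inequality of the projection. -/
lemma inner_nonneg_of_forall_norm_le {A : Set (Vec d)} (hA : Convex ℝ A) (hx' : x' ∈ A)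
    (h : ∀ x ∈ A, ‖x' - v‖ ≤ ‖x - v‖) {x : Vec d} (hx : x ∈ A) : 0 ≤ ⟪x' - v, x - x'⟫ := by
  have hinf : ‖v - x'‖ = ⨅ w : A, ‖v - w‖ := by
    have : Nonempty A := ⟨⟨x', hx'⟩⟩
    refine le_antisymm (le_ciInf fun w => ?_) (ciInf_le ⟨0, ?_⟩ (⟨x', hx'⟩ : A))
    · rw [norm_sub_rev, norm_sub_rev v]
      exact h w w.2
    · rintro _ ⟨w, rfl⟩
      exact norm_nonneg _
  have := (norm_eq_iInf_iff_real_inner_le_zero hA hx').1 hinf x hx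
  rw [← neg_sub v x', inner_neg_left]
  linarith

/-- The two variational inequalities, each tested at the other point, add up to -‖x' - p‖² ≥ 0. -/
lemma eq_of_forall_norm_le {A : Set (Vec d)} (hA : Convex ℝ A) {p : Vec d} (hx' : x' ∈ A)
    (hp : p ∈ A) (h : ∀ x ∈ A, ‖x' - v‖ ≤ ‖x - v‖) (h' : ∀ x ∈ A, ‖p - v‖ ≤ ‖x - v‖) :
    x' = p := by
  have h1 := inner_nonneg_of_forall_norm_le hA hx' h hp
  have h2 := inner_nonneg_of_forall_norm_le hA hp h' hx'
  have h3 : ⟪x' - v, p - x'⟫ + ⟪p - v, x' - p⟫ = -‖x' - p‖ ^ 2 := by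
    rw [← neg_sub x' p, inner_neg_right, ← sub_eq_neg_add, ← inner_sub_left,
      ← real_inner_self_eq_norm_sq, ← inner_neg_left]
    congr 1
    abel
  have h4 : ‖x' - p‖ ^ 2 ≤ 0 := by linarith
  have h5 : ‖x' - p‖ = 0 := by nlinarith [norm_nonneg (x' - p)]
  exact sub_eq_zero.1 (norm_eq_zero.1 h5)

/-- The multiplier rule for minimization over the intersection of a convex set with an
`ℓ₁`-ball centred at one of its points. -/
lemma exists_multiplier (hX : Convex ℝ X) (hxk : xk ∈ X) (hψ : 0 < ψ) (hx' : x' ∈ X)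
    (hs : l1Norm (x' - xk) ≤ ψ) {a : Vec d}
    (h : ∀ x ∈ X, l1Norm (x - xk) ≤ ψ → 0 ≤ ⟪a, x - x'⟫) :
    ∃ w : Vec d, (∀ x ∈ X, 0 ≤ ⟪a + w, x - x'⟫) ∧
      ∀ b : Vec d, l1Norm b ≤ ψ → ⟪w, b⟫ ≤ ⟪w, x' - xk⟫ := by
  -- Separation in ℝ^d × ℝ: the open ball with negative heights against the epigraph over X of x ↦
  -- ⟪a, x - x'⟫. They are disjoint precisely because x' satisfies the variational inequality on the
  -- intersection.
  let A : Set (Vec d × ℝ) := {p | l1Norm (p.1 - xk) < ψ ∧ p.2 < 0}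
  let B : Set (Vec d × ℝ) := {p | p.1 ∈ X ∧ ⟪a, p.1 - x'⟫ ≤ p.2}
  have hA : Convex ℝ A := by
    rintro ⟨y, r⟩ ⟨hy, hr⟩ ⟨z, t⟩ ⟨hz, ht⟩ α β hα hβ hαβ
    simp only at hy hr hz ht
    refine ⟨?_, ?_⟩
    · have hy' : y ∈ {x : Vec d | l1Norm (x - xk) ≤ max (l1Norm (y - xk)) (l1Norm (z - xk))} :=
        le_max_left (l1Norm (y - xk)) (l1Norm (z - xk))
      have hm := convex_l1Norm_sub_le xk _ hy' (le_max_right (l1Norm (y - xk)) (l1Norm (z - xk)))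
        hα hβ hαβ
      exact lt_of_le_of_lt hm (max_lt hy hz)
    · exact convex_Iio (𝕜 := ℝ) (0 : ℝ) hr ht hα hβ hαβ
  have hAo : IsOpen A := by
    have h1 : Continuous fun p : Vec d × ℝ => l1Norm (p.1 - xk) :=
      continuous_l1Norm.comp (by fun_prop)
    exact (isOpen_lt h1 continuous_const).inter (isOpen_lt continuous_snd continuous_const)
  have hB : Convex ℝ B := by
    rintro ⟨y, r⟩ ⟨hy, hr⟩ ⟨z, t⟩ ⟨hz, ht⟩ α β hα hβ hαβ
    simp only at hy hr hz ht
    refine ⟨hX hy hz hα hβ hαβ, ?_⟩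
    have : α • y + β • z - x' = α • (y - x') + β • (z - x') := by
      have : x' = α • x' + β • x' := by rw [← add_smul, hαβ, one_smul]
      nth_rewrite 1 [this]
      module
    change ⟪a, α • y + β • z - x'⟫ ≤ α * r + β * t
    rw [this, inner_add_right, inner_smul_right, inner_smul_right]
    exact add_le_add (mul_le_mul_of_nonneg_left hr hα) (mul_le_mul_of_nonneg_left ht hβ)
  have hdisj : Disjoint A B := by
    rw [Set.disjoint_left]
    rintro ⟨y, r⟩ ⟨hy, hr⟩ ⟨hyX, hyr⟩
    have := h y hyX hy.le
    simp only at hr hyr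
    linarith
  obtain ⟨F, u, hFA, hFB⟩ := geometric_hahn_banach_open hA hAo hB hdisj
  set ℓ : Vec d →L[ℝ] ℝ := F.comp (ContinuousLinearMap.inl ℝ (Vec d) ℝ) with hℓ
  set α : ℝ := F (0, 1) with hα
  have hF : ∀ y r, F (y, r) = ℓ y + r * α := by
    intro y r
    have : (y, r) = (y, (0 : ℝ)) + r • ((0 : Vec d), (1 : ℝ)) := by simp
    rw [this, map_add, map_smul, smul_eq_mul]
    rfl
  -- The Slater condition: xk lies in X and in the interior of the ball, so the separating
  -- hyperplane is not vertical.
  have hα0 : 0 < α := by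
    have h1 := hFA (xk, -1) ⟨by simpa [l1Norm_zero] using hψ, by simp⟩
    have h2 := hFB (xk, |⟪a, xk - x'⟫|) ⟨hxk, le_abs_self _⟩
    rw [hF] at h1 h2
    nlinarith [abs_nonneg ⟪a, xk - x'⟫]
  have hlt : ∀ y, l1Norm (y - xk) < ψ → ℓ y ≤ u := by
    intro y hy
    refine le_of_forall_pos_le_add fun r hr => ?_
    have h1 := hFA (y, -(r / α)) ⟨hy, by simpa using div_pos hr hα0⟩
    rw [hF, neg_mul, div_mul_cancel₀ _ hα0.ne'] at h1
    linarith
  have hle : ∀ b, l1Norm b ≤ ψ → ℓ (xk + b) ≤ u := by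
    intro b hb
    have ht : Filter.Tendsto (fun t : ℝ => ℓ (xk + t • b)) (𝓝[<] 1) (𝓝 (ℓ (xk + b))) := by
      have : ContinuousAt (fun t : ℝ => ℓ (xk + t • b)) 1 := by fun_prop
      simpa [ContinuousAt] using this.tendsto.mono_left nhdsWithin_le_nhds
    refine le_of_tendsto ht ?_
    filter_upwards [Ioo_mem_nhdsLT (show (0 : ℝ) < 1 by norm_num)] with t ht
    refine hlt _ ?_
    rw [add_sub_cancel_left, l1Norm_smul, abs_of_pos ht.1]
    rcases (l1Norm_nonneg b).eq_or_lt with h0 | h0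
    · rw [← h0, mul_zero]
      exact hψ
    · nlinarith [ht.2]
  -- The point (x', 0) belongs to the epigraph and to the closure of the other set, so the
  -- separation is tight there.
  have hx'u : ℓ x' = u := by
    refine le_antisymm ?_ ?_
    · simpa using hle (x' - xk) hs
    · have := hFB (x', 0) ⟨hx', by simp⟩
      rwa [hF, zero_mul, add_zero] at this
  have hw : ∀ y, ⟪α⁻¹ • (InnerProductSpace.toDual ℝ (Vec d)).symm ℓ, y⟫ = α⁻¹ * ℓ y := by
    intro y
    rw [real_inner_smul_left, InnerProductSpace.toDual_symm_apply]
  refine ⟨α⁻¹ • (InnerProductSpace.toDual ℝ (Vec d)).symm ℓ, fun x hx => ?_, fun b hb => ?_⟩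
  · have h1 := hFB (x, ⟪a, x - x'⟫) ⟨hx, le_rfl⟩
    rw [hF] at h1
    rw [inner_add_left, hw, map_sub, hx'u]
    have h2 : α * (⟪a, x - x'⟫ + α⁻¹ * (ℓ x - u)) = ⟪a, x - x'⟫ * α + (ℓ x - u) := by
      field_simp
    have h3 : 0 ≤ α * (⟪a, x - x'⟫ + α⁻¹ * (ℓ x - u)) := by linarith
    exact (mul_nonneg_iff_of_pos_left hα0).1 h3
  · rw [hw, hw]
    refine mul_le_mul_of_nonneg_left ?_ (inv_pos.2 hα0).le
    have := hle b hb
    rw [map_add] at this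
    rw [map_sub]
    linarith

end Prox

/-! ### Measurability of the proximal step -/

section ProxMeasurable

variable {X : Set (Vec d)} {ψ : ℝ}

/-- The closed graph property of the proximal step. -/
lemma isProxProj_of_tendsto (hXc : IsClosed X) (hX : Convex ℝ X) (hψ : 0 < ψ)
    {y v p : ℕ → Vec d} {y₀ v₀ p₀ : Vec d} (hyX : ∀ n, y n ∈ X)
    (hp : ∀ n, IsProxProj X (indicatorFn (l1Ball d ψ)) (y n) (v n) (p n))
    (hy : Filter.Tendsto y Filter.atTop (𝓝 y₀)) (hv : Filter.Tendsto v Filter.atTop (𝓝 v₀))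
    (hp₀ : Filter.Tendsto p Filter.atTop (𝓝 p₀)) :
    IsProxProj X (indicatorFn (l1Ball d ψ)) y₀ v₀ p₀ := by
  have hy₀ : y₀ ∈ X := hXc.isSeqClosed hyX hy
  simp only [isProxProj_indicatorFn_iff (hyX _) hψ.le] at hp
  rw [isProxProj_indicatorFn_iff hy₀ hψ.le]
  refine ⟨hXc.isSeqClosed (fun n => (hp n).1) hp₀,
    le_of_tendsto' ((continuous_l1Norm.tendsto _).comp (hp₀.sub hy)) fun n => (hp n).2.1,
    fun x hx hxψ => ?_⟩
  -- The constraint set moves with n. Shrinking the competitor x towards y₀ puts it strictly inside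
  -- the limiting ball, hence inside the n-th ball eventually; then t → 1.
  have ht : Filter.Tendsto (fun t : ℝ => ‖y₀ + t • (x - y₀) - v₀‖) (𝓝[<] 1) (𝓝 ‖x - v₀‖) := by
    have : ContinuousAt (fun t : ℝ => ‖y₀ + t • (x - y₀) - v₀‖) 1 := by fun_prop
    simpa [ContinuousAt] using this.tendsto.mono_left nhdsWithin_le_nhds
  refine ge_of_tendsto ht ?_
  filter_upwards [Ioo_mem_nhdsLT (show (0 : ℝ) < 1 by norm_num)] with t ht
  have hmem : y₀ + t • (x - y₀) ∈ X := hX.add_smul_sub_mem hy₀ hx ⟨ht.1.le, ht.2.le⟩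
  have hlim : Filter.Tendsto (fun n => l1Norm (y₀ + t • (x - y₀) - y n)) Filter.atTop
      (𝓝 (l1Norm (t • (x - y₀)))) := by
    have := (continuous_l1Norm.tendsto _).comp (hy.const_sub (y₀ + t • (x - y₀)))
    simpa [Function.comp_def] using this
  have hlt : l1Norm (t • (x - y₀)) < ψ := by
    rw [l1Norm_smul, abs_of_pos ht.1]
    rcases (l1Norm_nonneg (x - y₀)).eq_or_lt with h0 | h0
    · rw [← h0, mul_zero]
      exact hψ
    · nlinarith [ht.2]
  refine le_of_tendsto_of_tendsto (hp₀.sub hv).norm (hv.const_sub _).norm ?_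
  filter_upwards [hlim.eventually (gt_mem_nhds hlt)] with n hn
  exact (hp n).2.2 _ hmem hn.le

lemma IsProxProj.unique (hX : Convex ℝ X) (hψ : 0 ≤ ψ) {y v p p' : Vec d} (hy : y ∈ X)
    (hp : IsProxProj X (indicatorFn (l1Ball d ψ)) y v p)
    (hp' : IsProxProj X (indicatorFn (l1Ball d ψ)) y v p') : p = p' := by
  rw [isProxProj_indicatorFn_iff hy hψ] at hp hp'
  exact eq_of_forall_norm_le (hX.inter (convex_l1Norm_sub_le y ψ)) ⟨hp.1, hp.2.1⟩
    ⟨hp'.1, hp'.2.1⟩ (fun x hx => hp.2.2 x hx.1 hx.2) (fun x hx => hp'.2.2 x hx.1 hx.2)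

/-- The proximal step depends continuously on the centre and on the projected point. -/
lemma continuous_proxProj (hXc : IsClosed X) (hX : Convex ℝ X) (hψ : 0 < ψ)
    {D : Set (Vec d × Vec d)} (hD : ∀ u ∈ D, u.1 ∈ X) {p : D → Vec d}
    (hp : ∀ u : D, IsProxProj X (indicatorFn (l1Ball d ψ)) u.1.1 u.1.2 (p u)) :
    Continuous p := by
  rw [← continuousOn_univ, continuousOn_univ, continuous_iff_seqContinuous]
  intro u u₀ hu
  -- The outputs stay within ψ of convergent centres, so they are precompact; by the closed graph
  -- and uniqueness every cluster point is the value at the limit.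
  refine Filter.tendsto_of_subseq_tendsto fun ns hns => ?_
  have hu' := (continuous_subtype_val.tendsto u₀).comp (hu.comp hns)
  have hu1 := (continuous_fst.tendsto _).comp hu'
  have hu2 := (continuous_snd.tendsto _).comp hu'
  have hb : Bornology.IsBounded (Set.range fun n => p (u (ns n))) := by
    obtain ⟨R, hR⟩ := (Metric.isBounded_iff_subset_closedBall 0).1
      (Metric.isBounded_range_of_tendsto _ hu1)
    refine (Metric.isBounded_iff_subset_closedBall 0).2 ⟨R + ψ, ?_⟩
    rintro _ ⟨n, rfl⟩
    have h1 : ‖(u (ns n)).1.1‖ ≤ R := by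
      simpa using hR ⟨n, rfl⟩
    have h2 := ((isProxProj_indicatorFn_iff (hD _ (u (ns n)).2) hψ.le).1 (hp (u (ns n)))).2.1
    rw [mem_closedBall_zero_iff]
    have h3 := (norm_le_l1Norm _).trans h2
    have h4 := norm_le_norm_add_norm_sub' (p (u (ns n))) (u (ns n)).1.1
    linarith
  obtain ⟨w, -, φ, hφ, hw⟩ := tendsto_subseq_of_bounded hb fun n => Set.mem_range_self n
  have hlim := isProxProj_of_tendsto hXc hX hψ (fun n => hD _ (u (ns (φ n))).2)
    (fun n => hp (u (ns (φ n)))) (hu1.comp hφ.tendsto_atTop) (hu2.comp hφ.tendsto_atTop) hw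
  rw [IsProxProj.unique hX hψ.le (hD _ u₀.2) (hp u₀) hlim]
  exact ⟨φ, hw⟩

lemma measurable_proxProj (hXc : IsClosed X) (hX : Convex ℝ X) (hψ : 0 < ψ) {S : Type*}
    {mS : MeasurableSpace S} {y v p : S → Vec d} (hyX : ∀ s, y s ∈ X) (hy : Measurable y)
    (hv : Measurable v) (hp : ∀ s, IsProxProj X (indicatorFn (l1Ball d ψ)) (y s) (v s) (p s)) :
    Measurable p := by
  let D : Set (Vec d × Vec d) :=
    {u | u.1 ∈ X ∧ ∃ p, IsProxProj X (indicatorFn (l1Ball d ψ)) u.1 u.2 p}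
  have hD : ∀ u : D, ∃ p, IsProxProj X (indicatorFn (l1Ball d ψ)) u.1.1 u.1.2 p := fun u => u.2.2
  choose g hg using hD
  have hgc : Continuous g := continuous_proxProj hXc hX hψ (fun u hu => hu.1) hg
  have hmem : ∀ s, (y s, v s) ∈ D := fun s => ⟨hyX s, p s, hp s⟩
  have : p = fun s => g ⟨(y s, v s), hmem s⟩ :=
    funext fun s => IsProxProj.unique hX hψ.le (hyX s) (hp s) (hg ⟨(y s, v s), hmem s⟩)
  rw [this]
  exact hgc.measurable.comp ((hy.prodMk hv).subtype_mk)

end ProxMeasurable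

/-! ### One step of the method -/

section Step

variable {f : Vec d → ℝ} {X : Set (Vec d)} {L : ℝ}

/-- The mean value theorem replaces integration along the segment; the price is the constant L in
place of L/2, which is harmless here. -/
lemma le_add_inner_gradient_add (hX : Convex ℝ X) (hf : Differentiable ℝ f) (hL : 0 ≤ L)
    (hg : ∀ x ∈ X, ∀ y ∈ X, linfNorm (gradient f x - gradient f y) ≤ L * l1Norm (x - y))
    {x y : Vec d} (hx : x ∈ X) (hy : y ∈ X) :
    f y ≤ f x + ⟪gradient f x, y - x⟫ + L * l1Norm (y - x) ^ 2 := by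
  obtain ⟨z, hz, hfz⟩ := domain_mvt (f := f) (s := X) (f' := fderiv ℝ f)
    (fun x _ => (hf x).hasFDerivAt.hasFDerivWithinAt) hX hx hy
  have hzX : z ∈ X := hX.segment_subset hx hy hz
  rw [segment_eq_image'] at hz
  obtain ⟨t, ht, rfl⟩ := hz
  set z := x + t • (y - x)
  have h1 : l1Norm (z - x) ≤ l1Norm (y - x) := by
    rw [add_sub_cancel_left, l1Norm_smul, abs_of_nonneg ht.1]
    exact mul_le_of_le_one_left (l1Norm_nonneg _) ht.2
  have h2 : ⟪gradient f z - gradient f x, y - x⟫ ≤ L * l1Norm (y - x) ^ 2 := by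
    calc ⟪gradient f z - gradient f x, y - x⟫
        ≤ linfNorm (gradient f z - gradient f x) * l1Norm (y - x) :=
          (le_abs_self _).trans (abs_inner_le _ _)
      _ ≤ L * l1Norm (y - x) * l1Norm (y - x) := by
          refine mul_le_mul_of_nonneg_right ((hg _ hzX _ hx).trans ?_) (l1Norm_nonneg _)
          exact mul_le_mul_of_nonneg_left h1 hL
      _ = _ := by ring
  rw [← inner_gradient_eq_fderiv] at hfz
  rw [inner_sub_left] at h2
  linarith

/-- The residual after one proximal step, in terms of the error of the gradient estimate and of the
decrease of the objective. -/
lemma residual_proxProj_le (hX : Convex ℝ X) (hf : Differentiable ℝ f) (hL : 0 < L)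
    (hg : ∀ x ∈ X, ∀ y ∈ X, linfNorm (gradient f x - gradient f y) ≤ L * l1Norm (x - y))
    {ε : ℝ} (hε : 0 < ε) {xk x' G : Vec d} (hxk : xk ∈ X)
    (hp : IsProxProj X (indicatorFn (l1Ball d (ε / L))) xk (xk - (1 / L) • G) x') :
    0 ≤ 3 * ε + 2 * linfNorm (G - gradient f xk) + L / ε * (f xk - f x') ∧
    residual f X x' ≤ ENNReal.ofReal
      (3 * ε + 2 * linfNorm (G - gradient f xk) + L / ε * (f xk - f x')) := by
  have hψ : 0 < ε / L := div_pos hε hL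
  obtain ⟨hx', hs, hmin⟩ := (isProxProj_indicatorFn_iff hxk hψ.le).1 hp
  set s := x' - xk with hs_def
  set a := x' - (xk - (1 / L) • G) with ha_def
  have ha : a = s + (1 / L) • G := by rw [ha_def, hs_def]; abel
  have hvar : ∀ x ∈ X, l1Norm (x - xk) ≤ ε / L → 0 ≤ ⟪a, x - x'⟫ := fun x hx hxψ =>
    inner_nonneg_of_forall_norm_le (hX.inter (convex_l1Norm_sub_le xk (ε / L))) ⟨hx', hs⟩
      (fun y hy => hmin y hy.1 hy.2) ⟨hx, hxψ⟩
  obtain ⟨w, hw, hwb⟩ := exists_multiplier hX hxk hψ hx' hs hvar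
  have hws : 0 ≤ ⟪w, s⟫ := by
    have := hwb 0 (by rw [l1Norm_zero]; exact hψ.le)
    rwa [inner_zero_right] at this
  have hwn : ε / L * linfNorm w ≤ ⟪w, s⟫ := mul_linfNorm_le_of_inner_le hψ.le hws hwb
  -- The multiplier inequality tested at xk, with the favourable term ‖s‖² dropped.
  have hws' : ⟪w, s⟫ ≤ -(1 / L) * ⟪G, s⟫ := by
    have h1 := hw xk hxk
    rw [show xk - x' = -s by rw [hs_def]; abel, inner_neg_right, ha, inner_add_left,
      inner_add_left, real_inner_smul_left, real_inner_self_eq_norm_sq] at h1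
    nlinarith [sq_nonneg ‖s‖]
  set e := linfNorm (G - gradient f xk) with he
  have hGs : ⟪gradient f xk, s⟫ ≤ ⟪G, s⟫ + e * (ε / L) := by
    have h1 := (abs_le.1 (abs_inner_le (G - gradient f xk) s)).1
    have h2 := mul_le_mul_of_nonneg_left hs (linfNorm_nonneg (G - gradient f xk))
    rw [inner_sub_left] at h1
    linarith
  have hdesc := le_add_inner_gradient_add hX hf hL.le hg hxk hx'
  have hLs : L * l1Norm s ^ 2 ≤ ε * (ε / L) := by
    have := pow_le_pow_left₀ (l1Norm_nonneg s) hs 2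
    calc L * l1Norm s ^ 2 ≤ L * (ε / L) ^ 2 := mul_le_mul_of_nonneg_left this hL.le
      _ = _ := by field_simp
  -- The three bounds on ⟪w, s⟫ are chained and multiplied by L²/ε.
  have hLw : L * linfNorm w ≤ L / ε * (f xk - f x') + ε + e := by
    have h1 : ε / L * linfNorm w ≤ 1 / L * (f xk - f x' + ε * (ε / L) + e * (ε / L)) := by
      refine hwn.trans (hws'.trans ?_)
      rw [neg_mul, ← mul_neg]
      refine mul_le_mul_of_nonneg_left ?_ (by positivity)
      linarith
    have h2 := mul_le_mul_of_nonneg_left h1 (show 0 ≤ L * (L / ε) by positivity)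
    have h3 : L * (L / ε) * (ε / L * linfNorm w) = L * linfNorm w := by field_simp
    have h4 : L * (L / ε) * (1 / L * (f xk - f x' + ε * (ε / L) + e * (ε / L))) =
        L / ε * (f xk - f x') + ε + e := by field_simp
    rwa [h3, h4] at h2
  have hLs1 : L * l1Norm s ≤ ε := by
    calc L * l1Norm s ≤ L * (ε / L) := mul_le_mul_of_nonneg_left hs hL.le
      _ = ε := by field_simp
  -- This is the subgradient that witnesses the residual, since -L(a + w) is normal to X at x'.
  have hv : linfNorm (gradient f x' - L • (a + w)) ≤
      3 * ε + 2 * e + L / ε * (f xk - f x') := by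
    have hdecomp : gradient f x' - L • (a + w) =
        (gradient f x' - gradient f xk) - (G - gradient f xk) - L • s - L • w := by
      rw [ha, smul_add, smul_add, smul_smul, mul_one_div_cancel hL.ne', one_smul]
      abel
    rw [hdecomp]
    have h1 := linfNorm_sub_le
      ((gradient f x' - gradient f xk) - (G - gradient f xk) - L • s) (L • w)
    have h2 := linfNorm_sub_le ((gradient f x' - gradient f xk) - (G - gradient f xk)) (L • s)
    have h3 := linfNorm_sub_le (gradient f x' - gradient f xk) (G - gradient f xk)
    have h4 := hg x' hx' xk hxk
    rw [linfNorm_smul, abs_of_pos hL] at h1 h2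
    have h5 := mul_le_mul_of_nonneg_left (linfNorm_le_l1Norm s) hL.le
    linarith
  refine ⟨(linfNorm_nonneg _).trans hv, (residual_le hX (hf x') hx' fun z hz => ?_).trans
    (ENNReal.ofReal_le_ofReal hv)⟩
  rw [sub_sub_cancel_left, inner_neg_left, real_inner_smul_left]
  have := mul_nonneg hL.le (hw z hz)
  linarith

end Step

/-! ### Stochastic gradients -/

section StochGrad

lemma measurable_of_apply {S : Type*} {mS : MeasurableSpace S} {g : S → Vec d}
    (h : ∀ i, Measurable fun s => g s i) : Measurable g :=
  (WithLp.measurable_toLp 2 (Fin d → ℝ)).comp (measurable_pi_lambda (fun s i => g s i) h)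

lemma gradient_apply (f : Vec d → ℝ) (x : Vec d) (i : Fin d) :
    gradient f x i = fderiv ℝ f x (EuclideanSpace.single i 1) := by
  rw [← inner_gradient_eq_fderiv, EuclideanSpace.inner_single_right]
  simp

/-- The gradient of a function that is differentiable in one variable and measurable in the other
one is jointly measurable. -/
lemma measurable_stochGrad {Ξ : Type*} [MeasurableSpace Ξ] {F : Vec d → Ξ → ℝ}
    (hm : ∀ x, Measurable (F x)) (hd : ∀ z, Differentiable ℝ fun x => F x z) :
    Measurable fun p : Vec d × Ξ => stochGrad F p.1 p.2 := by
  have hF : Measurable (Function.uncurry F) := by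
    have h := measurable_uncurry_of_continuous_of_measurable (u := F)
      (fun z => (hd z).continuous) hm
    exact h
  refine measurable_of_apply fun i => ?_
  -- Each partial derivative is a pointwise limit of difference quotients with step 1/n, and these
  -- are jointly measurable.
  have hlim : ∀ p : Vec d × Ξ, Filter.Tendsto (fun n : ℕ => (n : ℝ) •
      (F (p.1 + (n : ℝ)⁻¹ • EuclideanSpace.single i 1) p.2 - F p.1 p.2)) Filter.atTop
      (𝓝 (stochGrad F p.1 p.2 i)) := by
    intro p
    rw [stochGrad, gradient_apply]
    exact (((hd p.2) p.1).hasFDerivAt.lim_real (EuclideanSpace.single i 1)).comp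
      tendsto_natCast_atTop_atTop
  refine measurable_of_tendsto_metrizable (f := fun (n : ℕ) (p : Vec d × Ξ) => (n : ℝ) •
      (F (p.1 + (n : ℝ)⁻¹ • EuclideanSpace.single i 1) p.2 - F p.1 p.2)) (fun n => ?_)
    (tendsto_pi_nhds.2 hlim)
  have h1 : Measurable fun p : Vec d × Ξ =>
      F (p.1 + (n : ℝ)⁻¹ • EuclideanSpace.single i 1) p.2 :=
    hF.comp (Measurable.prodMk (by fun_prop) measurable_snd)
  exact (h1.sub hF).const_smul (n : ℝ)

lemma measurable_gradient (f : Vec d → ℝ) : Measurable (gradient f) := by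
  refine measurable_of_apply fun i => ?_
  simp only [gradient_apply]
  exact measurable_fderiv_apply_const ℝ f _

lemma linfNorm_integral_le {Ξ : Type*} [MeasurableSpace Ξ] {P : Measure Ξ} {D : Ξ → Vec d}
    (hD : Integrable D P) (hn : Integrable (fun z => linfNorm (D z)) P) :
    linfNorm (∫ z, D z ∂P) ≤ ∫ z, linfNorm (D z) ∂P := by
  refine linfNorm_le (integral_nonneg fun z => linfNorm_nonneg _) fun i => ?_
  have hi : (∫ z, D z ∂P) i = ∫ z, D z i ∂P :=
    ((EuclideanSpace.proj (𝕜 := ℝ) i).integral_comp_comm hD).symm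
  rw [hi]
  refine (abs_integral_le_integral_abs).trans (integral_mono_of_nonneg
    (Filter.Eventually.of_forall fun z => abs_nonneg _) hn
    (Filter.Eventually.of_forall fun z => abs_apply_le_linfNorm _ i))

lemma integrable_linfNorm {Ξ : Type*} [MeasurableSpace Ξ] {P : Measure Ξ} {D : Ξ → Vec d}
    (hD : Integrable D P) : Integrable (fun z => linfNorm (D z)) P := by
  refine hD.norm.mono' (continuous_linfNorm.comp_aestronglyMeasurable hD.aestronglyMeasurable)
    (Filter.Eventually.of_forall fun z => ?_)
  rw [Real.norm_eq_abs, abs_of_nonneg (linfNorm_nonneg _)]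
  exact linfNorm_le (norm_nonneg _) fun i => PiLp.norm_apply_le (D z) i

/-- Integrate g ≤ g²/(2t) + t/2 with t = r + δ; the extra δ covers r = 0. -/
lemma integral_le_of_integral_sq_le {Ξ : Type*} [MeasurableSpace Ξ] {P : Measure Ξ}
    [IsProbabilityMeasure P] {g : Ξ → ℝ} {r : ℝ} (hr : 0 ≤ r) (hg : Integrable g P)
    (hg2 : Integrable (fun z => g z ^ 2) P) (h : ∫ z, g z ^ 2 ∂P ≤ r ^ 2) : ∫ z, g z ∂P ≤ r := by
  refine le_of_forall_pos_le_add fun δ hδ => ?_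
  have ht : 0 < r + δ := by linarith
  have h1 : ∫ z, g z ∂P ≤ ∫ z, (g z ^ 2 * (1 / (2 * (r + δ))) + (r + δ) / 2) ∂P := by
    refine integral_mono hg ((hg2.mul_const _).add (integrable_const _)) fun z => ?_
    have h0 : g z ^ 2 * (1 / (2 * (r + δ))) + (r + δ) / 2 - g z =
        (g z - (r + δ)) ^ 2 / (2 * (r + δ)) := by
      field_simp
      ring
    have h2 : 0 ≤ (g z - (r + δ)) ^ 2 / (2 * (r + δ)) := by positivity
    change g z ≤ g z ^ 2 * (1 / (2 * (r + δ))) + (r + δ) / 2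
    linarith
  rw [integral_add (hg2.mul_const _) (integrable_const _), integral_mul_const, integral_const,
    probReal_univ, one_smul] at h1
  have h3 : (∫ z, g z ^ 2 ∂P) * (1 / (2 * (r + δ))) ≤ (r + δ) / 2 := by
    rw [mul_one_div, div_le_div_iff₀ (by positivity) (by norm_num)]
    nlinarith
  linarith

variable {Ξ : Type*} [MeasurableSpace Ξ] {P : Measure Ξ}
  {X : Set (Vec d)} {F : Vec d → Ξ → ℝ} {L : ℝ}

lemma IsAdmissible.integral_sub (hF : IsAdmissible P X F) {x y : Vec d} (hx : x ∈ X)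
    (hy : y ∈ X) : ∫ z, (stochGrad F x z - stochGrad F y z) ∂P =
      gradient (objective P F) x - gradient (objective P F) y := by
  rw [MeasureTheory.integral_sub (hF.integrable_grad x hx) (hF.integrable_grad y hy),
    hF.unbiased x hx, hF.unbiased y hy]

variable [IsProbabilityMeasure P]

/-- Unbiasedness writes the gradient difference as a mean, and Jensen's inequality then bounds it by
the root mean square. -/
lemma IsAdmissible.linfNorm_gradient_sub_le (hF : IsAdmissible P X F) (hL : 0 ≤ L)
    (hs : MeanSquaredSmooth P X F L) : ∀ x ∈ X, ∀ y ∈ X,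
      linfNorm (gradient (objective P F) x - gradient (objective P F) y) ≤ L * l1Norm (x - y) := by
  intro x hx y hy
  have hD := (hF.integrable_grad x hx).sub (hF.integrable_grad y hy)
  rw [← hF.integral_sub hx hy]
  refine (linfNorm_integral_le hD (integrable_linfNorm hD)).trans ?_
  refine integral_le_of_integral_sq_le (mul_nonneg hL (l1Norm_nonneg _)) (integrable_linfNorm hD)
    (hs x hx y hy).1 ((hs x hx y hy).2.trans_eq (by ring))

lemma IsAdmissible.continuousOn_gradient (hF : IsAdmissible P X F) (hL : 0 ≤ L)
    (hs : MeanSquaredSmooth P X F L) : ContinuousOn (gradient (objective P F)) X := by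
  intro x hx
  rw [ContinuousWithinAt, tendsto_iff_norm_sub_tendsto_zero]
  have hlim : Filter.Tendsto (fun y => (d : ℝ) * (L * l1Norm (y - x))) (𝓝[X] x) (𝓝 0) := by
    have h : Continuous fun y => (d : ℝ) * (L * l1Norm (y - x)) :=
      continuous_const.mul (continuous_const.mul (continuous_l1Norm.comp (by fun_prop)))
    have := h.tendsto x
    rw [sub_self, l1Norm_zero, mul_zero, mul_zero] at this
    exact this.mono_left nhdsWithin_le_nhds
  refine squeeze_zero' (Filter.Eventually.of_forall fun y => norm_nonneg _) ?_ hlim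
  filter_upwards [self_mem_nhdsWithin] with y hy
  refine (norm_le_mul_linfNorm _).trans (mul_le_mul_of_nonneg_left ?_ (by positivity))
  exact hF.linfNorm_gradient_sub_le hL hs y hy x hx

/-- The second moment of the centred difference of stochastic gradients. -/
lemma IsAdmissible.integral_linfNorm_centred_sq_le (hF : IsAdmissible P X F) (hL : 0 ≤ L)
    (hs : MeanSquaredSmooth P X F L) {x y : Vec d} (hx : x ∈ X) (hy : y ∈ X) :
    Integrable (fun z => linfNorm (stochGrad F x z - stochGrad F y z -
      (gradient (objective P F) x - gradient (objective P F) y)) ^ 2) P ∧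
    ∫ z, linfNorm (stochGrad F x z - stochGrad F y z -
      (gradient (objective P F) x - gradient (objective P F) y)) ^ 2 ∂P ≤
        4 * (L ^ 2 * l1Norm (x - y) ^ 2) := by
  obtain ⟨hi, hle⟩ := hs x hx y hy
  set g := gradient (objective P F) x - gradient (objective P F) y with hg
  have hD := (hF.integrable_grad x hx).sub (hF.integrable_grad y hy)
  have hgn : linfNorm g ^ 2 ≤ L ^ 2 * l1Norm (x - y) ^ 2 := by
    rw [← mul_pow]
    exact pow_le_pow_left₀ (linfNorm_nonneg _) (hF.linfNorm_gradient_sub_le hL hs x hx y hy) 2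
  -- The sup norm is not Hilbertian, so centring may increase the second moment: (u + v)² ≤ 2u² +
  -- 2v² accounts for the factor 4.
  have hb : ∀ z, linfNorm (stochGrad F x z - stochGrad F y z - g) ^ 2 ≤
      2 * linfNorm (stochGrad F x z - stochGrad F y z) ^ 2 + 2 * linfNorm g ^ 2 := by
    intro z
    have h1 := linfNorm_sub_le (stochGrad F x z - stochGrad F y z) g
    have h2 := pow_le_pow_left₀ (linfNorm_nonneg _) h1 2
    nlinarith [sq_nonneg (linfNorm (stochGrad F x z - stochGrad F y z) - linfNorm g)]
  have hbi : Integrable (fun z => 2 * linfNorm (stochGrad F x z - stochGrad F y z) ^ 2 +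
      2 * linfNorm g ^ 2) P := (hi.const_mul 2).add (integrable_const _)
  have hint : Integrable (fun z => linfNorm (stochGrad F x z - stochGrad F y z - g) ^ 2) P := by
    refine hbi.mono' ?_ (Filter.Eventually.of_forall fun z => ?_)
    · exact (continuous_linfNorm.comp_aestronglyMeasurable
        (hD.aestronglyMeasurable.sub aestronglyMeasurable_const)).pow 2
    · rw [Real.norm_eq_abs, abs_of_nonneg (sq_nonneg _)]
      exact hb z
  refine ⟨hint, (integral_mono hint hbi hb).trans ?_⟩
  rw [integral_add (hi.const_mul 2) (integrable_const _), integral_const_mul, integral_const,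
    probReal_univ, one_smul]
  linarith

end StochGrad

/-! ### Independence of the past -/

section Independence

variable {S : Type*} {mS : MeasurableSpace S} {μ : Measure S}

/-- The intersections a ∩ b form a π-system generating A ⊔ B, and on it the product formula follows
by splitting off a, then b. -/
lemma indep_sup_left [IsProbabilityMeasure μ] {A B C : MeasurableSpace S} (hA : A ≤ mS)
    (hB : B ≤ mS) (hC : C ≤ mS) (h1 : Indep A (B ⊔ C) μ) (h2 : Indep B C μ) :
    Indep (A ⊔ B) C μ := by
  let p : Set (Set S) := {s | ∃ a b, MeasurableSet[A] a ∧ MeasurableSet[B] b ∧ a ∩ b = s}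
  have hp : A ⊔ B = MeasurableSpace.generateFrom p := by
    refine le_antisymm (sup_le (fun a ha => ?_) fun b hb => ?_)
      (MeasurableSpace.generateFrom_le ?_)
    · exact MeasurableSpace.measurableSet_generateFrom
        ⟨a, Set.univ, ha, MeasurableSet.univ, Set.inter_univ a⟩
    · exact MeasurableSpace.measurableSet_generateFrom
        ⟨Set.univ, b, MeasurableSet.univ, hb, Set.univ_inter b⟩
    · rintro _ ⟨a, b, ha, hb, rfl⟩
      exact MeasurableSet.inter (le_sup_left (b := B) a ha) (le_sup_right (a := A) b hb)
  refine IndepSets.indep (p1 := p) (p2 := {s | MeasurableSet[C] s}) (sup_le hA hB) hC ?_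
    (@MeasurableSpace.isPiSystem_measurableSet S C) hp
    (@MeasurableSpace.generateFrom_measurableSet S C).symm ?_
  · rintro _ ⟨a, b, ha, hb, rfl⟩ _ ⟨a', b', ha', hb', rfl⟩ -
    exact ⟨a ∩ a', b ∩ b', MeasurableSet.inter ha ha', MeasurableSet.inter hb hb',
      Set.inter_inter_inter_comm _ _ _ _⟩
  · rw [IndepSets_iff]
    rintro _ c ⟨a, b, ha, hb, rfl⟩ hc
    rw [Indep_iff] at h1 h2
    rw [Set.inter_assoc, h1 a (b ∩ c) ha
      (MeasurableSet.inter (le_sup_left (b := C) b hb) (le_sup_right (a := B) c hc)),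
      h2 b c hb hc, h1 a b ha (le_sup_left (b := C) b hb), mul_assoc]

variable {Ξ : Type*} [MeasurableSpace Ξ] {E : Type*} [MeasurableSpace E]

/-- The `σ`-algebra generated by the starting point and the samples with indices in `T`. -/
@[reducible]
def history (x₁ : S → E) (ζ : ℕ → ℕ → S → Ξ) (T : Set (ℕ × ℕ)) : MeasurableSpace S :=
  MeasurableSpace.comap x₁ inferInstance ⊔
    ⨆ p ∈ T, MeasurableSpace.comap (ζ p.1 p.2) inferInstance

variable {x₁ : S → E} {ζ : ℕ → ℕ → S → Ξ} {T T' : Set (ℕ × ℕ)}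

lemma history_mono (h : T ⊆ T') : history x₁ ζ T ≤ history x₁ ζ T' :=
  sup_le_sup_left (biSup_mono fun _ hp => h hp) _

lemma measurable_init_history : Measurable[history x₁ ζ T] x₁ :=
  (comap_measurable x₁).mono le_sup_left le_rfl

lemma measurable_sample_history {k i : ℕ} (h : (k, i) ∈ T) : Measurable[history x₁ ζ T] (ζ k i) :=
  (comap_measurable (ζ k i)).mono
    ((le_iSup₂_of_le (f := fun (p : ℕ × ℕ) (_ : p ∈ T) =>
      MeasurableSpace.comap (ζ p.1 p.2) inferInstance) (k, i) h le_rfl).trans le_sup_right) le_rfl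

lemma history_le (hx : Measurable x₁) (hζ : ∀ k i, Measurable (ζ k i)) : history x₁ ζ T ≤ mS :=
  sup_le hx.comap_le (iSup₂_le fun p _ => (hζ p.1 p.2).comap_le)

lemma history_le_comap : history x₁ ζ T ≤
    MeasurableSpace.comap (fun s => (x₁ s, fun k i => ζ k i s)) inferInstance := by
  have h := comap_measurable (m := inferInstance) (fun s => (x₁ s, fun k i => ζ k i s))
  refine sup_le ?_ (iSup₂_le fun p _ => ?_)
  · exact (measurable_fst.comp h).comap_le
  · exact ((measurable_pi_apply p.2).comp
      ((measurable_pi_apply p.1).comp (measurable_snd.comp h))).comap_le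

/-- The starting point is independent of all samples jointly, and disjoint families of samples are
independent of each other. -/
lemma indep_history [IsProbabilityMeasure μ] (hx : Measurable x₁)
    (hζ : ∀ k i, Measurable (ζ k i)) (hi : iIndepFun (fun p : ℕ × ℕ => ζ p.1 p.2) μ)
    (hxζ : IndepFun x₁ (fun s k i => ζ k i s) μ) {k i : ℕ} (h : (k, i) ∉ T) :
    Indep (history x₁ ζ T) (MeasurableSpace.comap (ζ k i) inferInstance) μ := by
  have hle : ∀ p : ℕ × ℕ, MeasurableSpace.comap (ζ p.1 p.2) inferInstance ≤ mS :=
    fun p => (hζ p.1 p.2).comap_le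
  have hle' : ∀ p : ℕ × ℕ, MeasurableSpace.comap (ζ p.1 p.2) inferInstance ≤
      MeasurableSpace.comap (fun s k i => ζ k i s) inferInstance := fun p =>
    ((measurable_pi_apply p.2).comp ((measurable_pi_apply p.1).comp
      (comap_measurable fun s k i => ζ k i s))).comap_le
  refine indep_sup_left hx.comap_le (iSup₂_le fun p _ => hle p) (hle (k, i)) ?_ ?_
  · exact indep_of_indep_of_le_right hxζ (sup_le (iSup₂_le fun p _ => hle' p) (hle' (k, i)))
  · have := indep_iSup_of_disjoint hle ((iIndepFun_iff_iIndep _ _ _).1 hi)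
      (Set.disjoint_singleton_right.2 h)
    rwa [iSup_singleton] at this

end Independence

/-! ### The growth of the expected soft maximum -/

section Growth

variable {S Ξ B : Type*} {mS : MeasurableSpace S} [MeasurableSpace Ξ] [MeasurableSpace B]
  {μ : Measure S} [IsProbabilityMeasure μ] {P : Measure Ξ} [IsProbabilityMeasure P]

/-- The linear term of the smoothness inequality integrates to zero. Working in [0, ∞] spares a
proof that the soft maximum is integrable. -/
lemma lintegral_softmax_add_const_le [NeZero d] {β v : ℝ} (hβ : 0 < β) (e : Vec d) {ξ : Ξ → Vec d}
    (hint : Integrable ξ P) (hzero : ∫ z, ξ z ∂P = 0)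
    (hsq : Integrable (fun z => linfNorm (ξ z) ^ 2) P)
    (hv : ∫ z, linfNorm (ξ z) ^ 2 ∂P ≤ v) :
    ∫⁻ z, ENNReal.ofReal (softmax β (e + ξ z)) ∂P ≤
      ENNReal.ofReal (softmax β e) + ENNReal.ofReal (β / 2 * v) := by
  obtain ⟨w, hw⟩ := exists_softmax_add_le hβ e
  have hi1 : Integrable (fun z => ⟪w, ξ z⟫) P := hint.const_inner w
  have hi2 : Integrable (fun z => softmax β e + ⟪w, ξ z⟫ + β / 2 * linfNorm (ξ z) ^ 2) P :=
    ((integrable_const _).add hi1).add (hsq.const_mul _)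
  have hv0 : 0 ≤ v := (integral_nonneg fun z => sq_nonneg _).trans hv
  calc ∫⁻ z, ENNReal.ofReal (softmax β (e + ξ z)) ∂P
      ≤ ∫⁻ z, ENNReal.ofReal (softmax β e + ⟪w, ξ z⟫ + β / 2 * linfNorm (ξ z) ^ 2) ∂P :=
        lintegral_mono fun z => ENNReal.ofReal_le_ofReal (hw (ξ z))
    _ = ENNReal.ofReal (∫ z, (softmax β e + ⟪w, ξ z⟫ + β / 2 * linfNorm (ξ z) ^ 2) ∂P) :=
        (ofReal_integral_eq_lintegral_ofReal hi2 (Filter.Eventually.of_forall fun z =>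
          (softmax_nonneg hβ _).trans (hw (ξ z)))).symm
    _ ≤ ENNReal.ofReal (softmax β e + β / 2 * v) := by
        refine ENNReal.ofReal_le_ofReal ?_
        have h1 : Integrable (fun z => softmax β e + ⟪w, ξ z⟫) P := (integrable_const _).add hi1
        rw [integral_add h1 (hsq.const_mul _), integral_add (integrable_const _) hi1,
          integral_const, integral_const_mul, integral_inner hint, hzero, inner_zero_right,
          probReal_univ, one_smul, add_zero]
        have := mul_le_mul_of_nonneg_left hv (half_pos hβ).le
        linarith
    _ = _ := ENNReal.ofReal_add (softmax_nonneg hβ _) (by positivity)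

/-- Adding one conditionally centred increment, driven by a sample that is independent of the past,
increases the expected soft maximum by a multiple of the second moment of the increment. -/
lemma lintegral_softmax_add_le [NeZero d] {β v : ℝ} (hβ : 0 < β) {e : S → Vec d} {W : S → B}
    {Z : S → Ξ} (he : Measurable e) (hW : Measurable W) (hZ : Measurable Z) (hlaw : μ.map Z = P)
    (hind : IndepFun (fun s => (e s, W s)) Z μ) {ξ : B → Ξ → Vec d}
    (hξ : Measurable fun p : B × Ξ => ξ p.1 p.2) {A : Set B} (hA : ∀ s, W s ∈ A)
    (hint : ∀ b ∈ A, Integrable (ξ b) P) (hzero : ∀ b ∈ A, ∫ z, ξ b z ∂P = 0)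
    (hsq : ∀ b ∈ A, Integrable (fun z => linfNorm (ξ b z) ^ 2) P ∧
      ∫ z, linfNorm (ξ b z) ^ 2 ∂P ≤ v) :
    ∫⁻ s, ENNReal.ofReal (softmax β (e s + ξ (W s) (Z s))) ∂μ ≤
      ∫⁻ s, ENNReal.ofReal (softmax β (e s)) ∂μ + ENNReal.ofReal (β / 2 * v) := by
  have hU : Measurable fun s => (e s, W s) := he.prodMk hW
  have hH : Measurable fun p : (Vec d × B) × Ξ =>
      ENNReal.ofReal (softmax β (p.1.1 + ξ p.1.2 p.2)) := by
    refine ENNReal.measurable_ofReal.comp ((continuous_softmax β).measurable.comp ?_)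
    exact (measurable_fst.comp measurable_fst).add
      (hξ.comp ((measurable_snd.comp measurable_fst).prodMk measurable_snd))
  -- Independence makes the joint law a product, so Tonelli's theorem replaces conditional
  -- expectations by an inner integral at a frozen past.
  have hmap := (indepFun_iff_map_prod_eq_prod_map_map hU.aemeasurable hZ.aemeasurable).1 hind
  rw [hlaw] at hmap
  have : IsProbabilityMeasure (μ.map fun s => (e s, W s)) :=
    Measure.isProbabilityMeasure_map hU.aemeasurable
  calc ∫⁻ s, ENNReal.ofReal (softmax β (e s + ξ (W s) (Z s))) ∂μ
      = ∫⁻ p, ENNReal.ofReal (softmax β (p.1.1 + ξ p.1.2 p.2))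
          ∂(μ.map fun s => ((e s, W s), Z s)) := (lintegral_map hH (hU.prodMk hZ)).symm
    _ = ∫⁻ u, ∫⁻ z, ENNReal.ofReal (softmax β (u.1 + ξ u.2 z)) ∂P
          ∂(μ.map fun s => (e s, W s)) := by
        rw [hmap, lintegral_prod _ hH.aemeasurable]
    _ = ∫⁻ s, ∫⁻ z, ENNReal.ofReal (softmax β (e s + ξ (W s) z)) ∂P ∂μ :=
        lintegral_map hH.lintegral_prod_right' hU
    _ ≤ ∫⁻ s, (ENNReal.ofReal (softmax β (e s)) + ENNReal.ofReal (β / 2 * v)) ∂μ :=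
        lintegral_mono fun s => lintegral_softmax_add_const_le hβ (e s) (hint _ (hA s))
          (hzero _ (hA s)) (hsq _ (hA s)).1 (hsq _ (hA s)).2
    _ = _ := by
        rw [lintegral_add_right _ measurable_const, lintegral_const, measure_univ, mul_one]

/-- The version of `lintegral_softmax_add_le` for a batch of `b` samples. -/
lemma lintegral_softmax_add_sum_le [NeZero d] {β v : ℝ} (hβ : 0 < β) (hv : 0 ≤ v) {e : S → Vec d}
    {W : S → B} {Z : ℕ → S → Ξ} (he : Measurable e) (hW : Measurable W)
    (hZ : ∀ i, Measurable (Z i)) (hlaw : ∀ i, μ.map (Z i) = P) {ξ : B → Ξ → Vec d}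
    (hξ : Measurable fun p : B × Ξ => ξ p.1 p.2) {A : Set B} (hA : ∀ s, W s ∈ A)
    (hint : ∀ b ∈ A, Integrable (ξ b) P) (hzero : ∀ b ∈ A, ∫ z, ξ b z ∂P = 0)
    (hsq : ∀ b ∈ A, Integrable (fun z => linfNorm (ξ b z) ^ 2) P ∧
      ∫ z, linfNorm (ξ b z) ^ 2 ∂P ≤ v)
    (hind : ∀ i, IndepFun
      (fun s => (e s + ∑ j ∈ Finset.range i, ξ (W s) (Z j s), W s)) (Z i) μ) (b : ℕ) :
    ∫⁻ s, ENNReal.ofReal (softmax β (e s + ∑ j ∈ Finset.range b, ξ (W s) (Z j s))) ∂μ ≤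
      ∫⁻ s, ENNReal.ofReal (softmax β (e s)) ∂μ + ENNReal.ofReal (β / 2 * (b * v)) := by
  induction b with
  | zero => simp
  | succ b ih =>
    have hpart : Measurable fun s => e s + ∑ j ∈ Finset.range b, ξ (W s) (Z j s) :=
      he.add (Finset.measurable_fun_sum _ fun j _ => hξ.comp (hW.prodMk (hZ j)))
    have h := lintegral_softmax_add_le hβ hpart hW (hZ b) (hlaw b) (hind b) hξ hA hint hzero hsq
    simp only [Finset.sum_range_succ, ← add_assoc]
    refine h.trans ((add_le_add_left ih _).trans_eq ?_)
    rw [add_assoc, ← ENNReal.ofReal_add (by positivity) (by positivity)]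
    congr 2
    push_cast
    ring

end Growth

/-! ### The iterates -/

section Iterates

variable {Ξ : Type*} {X : Set (Vec d)} {F : Vec d → Ξ → ℝ} {η ψ : ℝ} {q m₁ m K : ℕ}

lemma refreshIndex_succ_eq_iff (q n : ℕ) : n + 1 = refreshIndex q (n + 1) ↔ n % q = 0 := by
  have := Nat.div_add_mod n q
  rw [mul_comm] at this
  simp only [refreshIndex, Nat.add_sub_cancel]
  omega

lemma IsRun.mem {z : ℕ → ℕ → Ξ} {x : ℕ → Vec d} (h : IsRun X F η ψ q m₁ m K z x) {k : ℕ}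
    (hk : 1 ≤ k) (hkK : k ≤ K + 1) : x k ∈ X := by
  rcases hk.eq_or_lt with rfl | hk
  · exact h.init_mem
  · obtain ⟨j, rfl⟩ : ∃ j, k = j + 1 := ⟨k - 1, by omega⟩
    exact (h.step j (by omega) (by omega)).1

/-- The indices of the samples used before iteration `k`. -/
def before (k : ℕ) : Set (ℕ × ℕ) := {p | p.1 < k}

/-- The indices of the samples used before sample `i` of iteration `k`. -/
def beforeSample (k i : ℕ) : Set (ℕ × ℕ) := {p | p.1 < k ∨ p.1 = k ∧ p.2 < i}

variable [MeasurableSpace Ξ] {P : Measure Ξ} {S : Type*} {mS : MeasurableSpace S} {μ : Measure S}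
  {x : ℕ → S → Vec d} {ζ : ℕ → ℕ → S → Ξ}

/-- The iterates and the estimates are functions of the past. -/
lemma measurable_iterates (hF : IsAdmissible P X F) (hψ : 0 < ψ)
    (hrun : ∀ s, IsRun X F η ψ q m₁ m K (fun k i => ζ k i s) (fun k => x k s)) :
    ∀ n ≤ K, Measurable[history (x 1) ζ (before (n + 1))] (x (n + 1)) ∧
      Measurable[history (x 1) ζ (before (n + 1))]
        (fun s => spiderEstimate F q m₁ m (fun k => x k s) (fun k i => ζ k i s) n) ∧
      (1 ≤ n → Measurable[history (x 1) ζ (before (n + 1))] (x n)) := by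
  have hG := measurable_stochGrad hF.measurable hF.differentiable
  intro n
  induction n with
  | zero =>
    intro _
    exact ⟨measurable_init_history, measurable_const, by simp⟩
  | succ n ih =>
    intro hn
    obtain ⟨h1, h2, h3⟩ := ih (by omega)
    have hle : history (x 1) ζ (before (n + 1)) ≤ history (x 1) ζ (before (n + 1 + 1)) :=
      history_mono fun p (hp : p.1 < n + 1) => show p.1 < n + 1 + 1 by omega
    have h1' := h1.mono hle le_rfl
    have h2' := h2.mono hle le_rfl
    have hζ : ∀ i, Measurable[history (x 1) ζ (before (n + 1 + 1))] (ζ (n + 1) i) := fun i =>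
      measurable_sample_history (show n + 1 < n + 1 + 1 by omega)
    have hest : Measurable[history (x 1) ζ (before (n + 1 + 1))]
        (fun s => spiderEstimate F q m₁ m (fun k => x k s) (fun k i => ζ k i s) (n + 1)) := by
      simp only [spiderEstimate]
      have hsum : Measurable[history (x 1) ζ (before (n + 1 + 1))] fun s =>
          ∑ i ∈ Finset.range (batchSize q m₁ m (n + 1)),
            stochGrad F (x (n + 1) s) (ζ (n + 1) i s) :=
        Finset.measurable_fun_sum _ fun i _ => hG.comp (h1'.prodMk (hζ i))
      split_ifs with hr
      · exact hsum.const_smul ((batchSize q m₁ m (n + 1) : ℝ)⁻¹)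
      · have hn1 : 1 ≤ n := by
          rw [refreshIndex_succ_eq_iff] at hr
          rcases Nat.eq_zero_or_pos n with rfl | h
          · simp at hr
          · exact h
        have h3' := (h3 hn1).mono hle le_rfl
        have hsum' : Measurable[history (x 1) ζ (before (n + 1 + 1))] fun s =>
            ∑ i ∈ Finset.range (batchSize q m₁ m (n + 1)), stochGrad F (x n s) (ζ (n + 1) i s) :=
          Finset.measurable_fun_sum _ fun i _ => hG.comp (h3'.prodMk (hζ i))
        exact ((hsum.sub hsum').const_smul ((batchSize q m₁ m (n + 1) : ℝ)⁻¹)).add h2'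
    refine ⟨?_, hest, fun _ => h1'⟩
    refine measurable_proxProj hF.isClosed hF.convex hψ
      (fun s => (hrun s).mem (k := n + 1) (by omega) (by omega)) h1' (h1'.sub (hest.const_smul η))
      fun s => (hrun s).step (n + 1) (by omega) hn

end Iterates

/-! ### The error of the gradient estimate -/

section Error

lemma sum_range_inv_smul_sub {b : ℕ} (hb : b ≠ 0) (a : ℕ → Vec d) (g : Vec d) :
    ∑ i ∈ Finset.range b, (b : ℝ)⁻¹ • (a i - g) =
      (b : ℝ)⁻¹ • ∑ i ∈ Finset.range b, a i - g := by
  rw [← Finset.smul_sum, Finset.sum_sub_distrib, Finset.sum_const, Finset.card_range, smul_sub,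
    ← Nat.cast_smul_eq_nsmul ℝ, smul_smul, inv_mul_cancel₀ (by exact_mod_cast hb), one_smul]

lemma spiderEstimate_of_mod_eq_zero {Ξ : Type*} (F : Vec d → Ξ → ℝ) {q m₁ m n : ℕ}
    (x : ℕ → Vec d) (z : ℕ → ℕ → Ξ) (h : n % q = 0) :
    spiderEstimate F q m₁ m x z (n + 1) =
      (m₁ : ℝ)⁻¹ • ∑ i ∈ Finset.range m₁, stochGrad F (x (n + 1)) (z (n + 1) i) := by
  have hr := (refreshIndex_succ_eq_iff q n).2 h
  rw [spiderEstimate, if_pos hr, batchSize, if_pos hr]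

lemma spiderEstimate_of_mod_ne_zero {Ξ : Type*} (F : Vec d → Ξ → ℝ) {q m₁ m n : ℕ}
    (x : ℕ → Vec d) (z : ℕ → ℕ → Ξ) (h : n % q ≠ 0) :
    spiderEstimate F q m₁ m x z (n + 1) =
      (m : ℝ)⁻¹ • ∑ i ∈ Finset.range m,
        (stochGrad F (x (n + 1)) (z (n + 1) i) - stochGrad F (x n) (z (n + 1) i)) +
      spiderEstimate F q m₁ m x z n := by
  have hr := (refreshIndex_succ_eq_iff q n).not.2 h
  rw [spiderEstimate, if_neg hr, batchSize, if_neg hr, Finset.sum_sub_distrib]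

lemma succ_mod_of_ne_zero {n q : ℕ} (h : (n + 1) % q ≠ 0) : (n + 1) % q = n % q + 1 := by
  rcases Nat.lt_or_ge 1 q with hq | hq
  · rw [Nat.add_mod_eq_ite, Nat.mod_eq_of_lt hq] at *
    split_ifs at * with h1
    · have := Nat.mod_lt n (show 0 < q by omega)
      omega
    · rfl
  · interval_cases q
    · simp
    · simp [Nat.mod_one] at h

variable {Ξ : Type*} {X : Set (Vec d)} {F : Vec d → Ξ → ℝ} {η ψ ε σ L : ℝ} {q m₁ m K : ℕ}
  [MeasurableSpace Ξ] {P : Measure Ξ} {S : Type*} {mS : MeasurableSpace S}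
  {μ : Measure S} {x : ℕ → S → Vec d} {ζ : ℕ → ℕ → S → Ξ} {Y : S → ℕ}

lemma IsSampling.indepFun_sample [IsProbabilityMeasure μ] (hs : IsSampling P μ K (x 1) ζ Y) {E : Type*} [MeasurableSpace E]
    {k i : ℕ} {U : S → E} (hU : Measurable[history (x 1) ζ (beforeSample k i)] U) :
    IndepFun U (ζ k i) μ :=
  indep_of_indep_of_le_left (indep_history hs.measurable_init hs.measurable_sample hs.indep_samples
    hs.indep_init (show (k, i) ∉ beforeSample k i by simp [beforeSample])) hU.comap_le

lemma before_subset_beforeSample (k i : ℕ) : before k ⊆ beforeSample k i := fun _ hp => Or.inl hp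

lemma IsSampling.history_le (hs : IsSampling P μ K (x 1) ζ Y) (T : Set (ℕ × ℕ)) :
    history (x 1) ζ T ≤ mS :=
  DISFOM.history_le hs.measurable_init hs.measurable_sample

variable [IsProbabilityMeasure P] [IsProbabilityMeasure μ]

/-- The error of the estimate from a large batch. -/
lemma lintegral_softmax_error_le_of_mod_eq_zero [NeZero d] (hF : IsAdmissible P X F)
    (hσ : BoundedVariance P X F σ) (hψ : 0 < ψ) (hm₁ : m₁ ≠ 0)
    (hs : IsSampling P μ K (x 1) ζ Y)
    (hrun : ∀ s, IsRun X F η ψ q m₁ m K (fun k i => ζ k i s) (fun k => x k s))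
    {β : ℝ} (hβ : 0 < β) {n : ℕ} (hn : n + 1 ≤ K) (hnq : n % q = 0) :
    ∫⁻ s, ENNReal.ofReal (softmax β
      (spiderEstimate F q m₁ m (fun k => x k s) (fun k i => ζ k i s) (n + 1) -
        gradient (objective P F) (x (n + 1) s))) ∂μ ≤
      ENNReal.ofReal (Real.log d / β + β / 2 * (σ ^ 2 / m₁)) := by
  have hG := measurable_stochGrad hF.measurable hF.differentiable
  have hg := measurable_gradient (objective P F)
  have hx := (measurable_iterates hF hψ hrun n (by omega)).1
  have hm₁' : (m₁ : ℝ) ≠ 0 := by exact_mod_cast hm₁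
  set g := gradient (objective P F) with hg_def
  -- The error is a sum, started at 0, of m₁ centred terms with second moment at most σ²/m₁² each.
  obtain ⟨ξ, hξ_def⟩ : ∃ ξ : Vec d → Ξ → Vec d,
      ξ = fun b z => (m₁ : ℝ)⁻¹ • (stochGrad F b z - g b) := ⟨_, rfl⟩
  have hξ : Measurable fun p : Vec d × Ξ => ξ p.1 p.2 := by
    rw [hξ_def]
    exact (hG.sub (hg.comp measurable_fst)).const_smul (m₁ : ℝ)⁻¹
  have hξn : ∀ b z, linfNorm (ξ b z) ^ 2 = ((m₁ : ℝ)⁻¹) ^ 2 * linfNorm (stochGrad F b z - g b) ^ 2 :=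
    fun b z => by rw [hξ_def, linfNorm_smul, mul_pow, sq_abs]
  have hint : ∀ b ∈ X, Integrable (ξ b) P := fun b hb => by
    rw [hξ_def]
    exact ((hF.integrable_grad b hb).sub (integrable_const (g b))).smul (m₁ : ℝ)⁻¹
  have hzero : ∀ b ∈ X, ∫ z, ξ b z ∂P = 0 := fun b hb => by
    rw [hξ_def, integral_smul, MeasureTheory.integral_sub (hF.integrable_grad b hb) (integrable_const _),
      hF.unbiased b hb, integral_const, probReal_univ, one_smul, sub_self, smul_zero]
  have hsq : ∀ b ∈ X, Integrable (fun z => linfNorm (ξ b z) ^ 2) P ∧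
      ∫ z, linfNorm (ξ b z) ^ 2 ∂P ≤ ((m₁ : ℝ)⁻¹) ^ 2 * σ ^ 2 := fun b hb => by
    simp only [hξn]
    refine ⟨(hσ b hb).1.const_mul _, ?_⟩
    rw [integral_const_mul]
    exact mul_le_mul_of_nonneg_left (hσ b hb).2 (by positivity)
  have hind : ∀ i, IndepFun (fun s => ((0 : Vec d) +
      ∑ j ∈ Finset.range i, ξ (x (n + 1) s) (ζ (n + 1) j s), x (n + 1) s)) (ζ (n + 1) i) μ := by
    intro i
    have hx' := hx.mono (history_mono (before_subset_beforeSample (n + 1) i)) le_rfl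
    refine hs.indepFun_sample (k := n + 1) (i := i) (Measurable.prodMk ?_ hx')
    have hz : ∀ j ∈ Finset.range i,
        Measurable[history (x 1) ζ (beforeSample (n + 1) i)] (ζ (n + 1) j) := fun j hj =>
      measurable_sample_history (Or.inr ⟨rfl, Finset.mem_range.1 hj⟩)
    have hsum : Measurable[history (x 1) ζ (beforeSample (n + 1) i)] fun s =>
        ∑ j ∈ Finset.range i, ξ (x (n + 1) s) (ζ (n + 1) j s) :=
      Finset.measurable_fun_sum _ fun j hj => hξ.comp (hx'.prodMk (hz j hj))
    exact measurable_const.add hsum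
  have hmain := lintegral_softmax_add_sum_le hβ (by positivity)
    measurable_const (hx.mono (hs.history_le _) le_rfl) (hs.measurable_sample (n + 1))
    (hs.law_sample (n + 1)) hξ (fun s => (hrun s).mem (k := n + 1) (by omega) (by omega))
    hint hzero hsq hind m₁
  have heq : ∀ s, spiderEstimate F q m₁ m (fun k => x k s) (fun k i => ζ k i s) (n + 1) -
      g (x (n + 1) s) = 0 + ∑ j ∈ Finset.range m₁, ξ (x (n + 1) s) (ζ (n + 1) j s) := by
    intro s
    rw [spiderEstimate_of_mod_eq_zero F _ _ hnq, zero_add, hξ_def, sum_range_inv_smul_sub hm₁]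
  simp only [heq]
  refine hmain.trans_eq ?_
  rw [lintegral_const, measure_univ, mul_one, softmax_zero,
    ← ENNReal.ofReal_add (div_nonneg (Real.log_natCast_nonneg d) hβ.le) (by positivity)]
  congr 2
  field_simp

/-- The growth of the error of the estimate caused by a small batch. -/
lemma lintegral_softmax_error_le_of_mod_ne_zero [NeZero d] (hF : IsAdmissible P X F)
    (hL : 0 < L) (hsm : MeanSquaredSmooth P X F L) (hε : 0 < ε)
    (hm : m ≠ 0) (hs : IsSampling P μ K (x 1) ζ Y)
    (hrun : ∀ s, IsRun X F η (ε / L) q m₁ m K (fun k i => ζ k i s) (fun k => x k s))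
    {β : ℝ} (hβ : 0 < β) {n : ℕ} (hn1 : 1 ≤ n) (hn : n + 1 ≤ K) (hnq : n % q ≠ 0) :
    ∫⁻ s, ENNReal.ofReal (softmax β
      (spiderEstimate F q m₁ m (fun k => x k s) (fun k i => ζ k i s) (n + 1) -
        gradient (objective P F) (x (n + 1) s))) ∂μ ≤
      ∫⁻ s, ENNReal.ofReal (softmax β
        (spiderEstimate F q m₁ m (fun k => x k s) (fun k i => ζ k i s) n -
          gradient (objective P F) (x n s))) ∂μ + ENNReal.ofReal (β / 2 * (4 * ε ^ 2 / m)) := by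
  have hψ : 0 < ε / L := div_pos hε hL
  have hG := measurable_stochGrad hF.measurable hF.differentiable
  have hg := measurable_gradient (objective P F)
  obtain ⟨hx, hest, hprev⟩ := measurable_iterates hF hψ hrun n (by omega)
  have hm' : (m : ℝ) ≠ 0 := by exact_mod_cast hm
  set g := gradient (objective P F) with hg_def
  obtain ⟨ξ, hξ_def⟩ : ∃ ξ : Vec d × Vec d → Ξ → Vec d, ξ = fun b z =>
      (m : ℝ)⁻¹ • (stochGrad F b.1 z - stochGrad F b.2 z - (g b.1 - g b.2)) := ⟨_, rfl⟩
  have hξ : Measurable fun p : (Vec d × Vec d) × Ξ => ξ p.1 p.2 := by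
    rw [hξ_def]
    exact (((hG.comp ((measurable_fst.comp measurable_fst).prodMk measurable_snd)).sub
      (hG.comp ((measurable_snd.comp measurable_fst).prodMk measurable_snd))).sub
      ((hg.comp (measurable_fst.comp measurable_fst)).sub
        (hg.comp (measurable_snd.comp measurable_fst)))).const_smul (m : ℝ)⁻¹
  have hξn : ∀ b z, linfNorm (ξ b z) ^ 2 = ((m : ℝ)⁻¹) ^ 2 *
      linfNorm (stochGrad F b.1 z - stochGrad F b.2 z - (g b.1 - g b.2)) ^ 2 :=
    fun b z => by rw [hξ_def, linfNorm_smul, mul_pow, sq_abs]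
  -- The radius constraint holds for every outcome, so pairs of consecutive iterates stay in a fixed
  -- set on which the second moment of an increment is uniformly bounded.
  let A : Set (Vec d × Vec d) := {b | b.1 ∈ X ∧ b.2 ∈ X ∧ l1Norm (b.1 - b.2) ≤ ε / L}
  have hA : ∀ s, (x (n + 1) s, x n s) ∈ A := by
    intro s
    have hn0 : x n s ∈ X := (hrun s).mem hn1 (by omega)
    have hstep := (isProxProj_indicatorFn_iff hn0 hψ.le).1 ((hrun s).step n hn1 (by omega))
    exact ⟨hstep.1, hn0, hstep.2.1⟩
  have hest' : Measurable[history (x 1) ζ (before (n + 1))] fun s =>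
      spiderEstimate F q m₁ m (fun k => x k s) (fun k i => ζ k i s) n - g (x n s) :=
    hest.sub (hg.comp (hprev hn1))
  have hW : Measurable[history (x 1) ζ (before (n + 1))] fun s => (x (n + 1) s, x n s) :=
    hx.prodMk (hprev hn1)
  have hD : ∀ b ∈ A, Integrable (fun z => stochGrad F b.1 z - stochGrad F b.2 z) P := fun b hb =>
    (hF.integrable_grad _ hb.1).sub (hF.integrable_grad _ hb.2.1)
  have hint : ∀ b ∈ A, Integrable (ξ b) P := fun b hb => by
    rw [hξ_def]
    exact ((hD b hb).sub (integrable_const (g b.1 - g b.2))).smul (m : ℝ)⁻¹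
  have hzero : ∀ b ∈ A, ∫ z, ξ b z ∂P = 0 := fun b hb => by
    rw [hξ_def, integral_smul, MeasureTheory.integral_sub (hD b hb) (integrable_const _),
      hF.integral_sub hb.1 hb.2.1, integral_const, probReal_univ, one_smul, sub_self, smul_zero]
  have hsq : ∀ b ∈ A, Integrable (fun z => linfNorm (ξ b z) ^ 2) P ∧
      ∫ z, linfNorm (ξ b z) ^ 2 ∂P ≤ ((m : ℝ)⁻¹) ^ 2 * (4 * ε ^ 2) := fun b hb => by
    simp only [hξn]
    obtain ⟨h1, h2⟩ := hF.integral_linfNorm_centred_sq_le hL.le hsm hb.1 hb.2.1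
    refine ⟨h1.const_mul _, ?_⟩
    rw [integral_const_mul]
    refine mul_le_mul_of_nonneg_left (h2.trans ?_) (by positivity)
    have h3 := pow_le_pow_left₀ (l1Norm_nonneg _) hb.2.2 2
    calc 4 * (L ^ 2 * l1Norm (b.1 - b.2) ^ 2) ≤ 4 * (L ^ 2 * (ε / L) ^ 2) := by gcongr
      _ = 4 * ε ^ 2 := by field_simp
  have hind : ∀ i, IndepFun (fun s =>
      (spiderEstimate F q m₁ m (fun k => x k s) (fun k i => ζ k i s) n - g (x n s) +
        ∑ j ∈ Finset.range i, ξ (x (n + 1) s, x n s) (ζ (n + 1) j s), (x (n + 1) s, x n s)))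
      (ζ (n + 1) i) μ := by
    intro i
    have hsub := history_mono (x₁ := x 1) (ζ := ζ) (before_subset_beforeSample (n + 1) i)
    have hW' := hW.mono hsub le_rfl
    refine hs.indepFun_sample (k := n + 1) (i := i) (Measurable.prodMk ?_ hW')
    have hz : ∀ j ∈ Finset.range i,
        Measurable[history (x 1) ζ (beforeSample (n + 1) i)] (ζ (n + 1) j) := fun j hj =>
      measurable_sample_history (Or.inr ⟨rfl, Finset.mem_range.1 hj⟩)
    have hsum : Measurable[history (x 1) ζ (beforeSample (n + 1) i)] fun s =>
        ∑ j ∈ Finset.range i, ξ (x (n + 1) s, x n s) (ζ (n + 1) j s) :=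
      Finset.measurable_fun_sum _ fun j hj => hξ.comp (hW'.prodMk (hz j hj))
    exact (hest'.mono hsub le_rfl).add hsum
  have hmain := lintegral_softmax_add_sum_le hβ (by positivity)
    (hest'.mono (hs.history_le _) le_rfl) (hW.mono (hs.history_le _) le_rfl)
    (hs.measurable_sample (n + 1)) (hs.law_sample (n + 1)) hξ hA hint hzero hsq hind m
  have heq : ∀ s, spiderEstimate F q m₁ m (fun k => x k s) (fun k i => ζ k i s) (n + 1) -
      g (x (n + 1) s) = spiderEstimate F q m₁ m (fun k => x k s) (fun k i => ζ k i s) n -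
        g (x n s) + ∑ j ∈ Finset.range m, ξ (x (n + 1) s, x n s) (ζ (n + 1) j s) := by
    intro s
    rw [spiderEstimate_of_mod_ne_zero F _ _ hnq, hξ_def, sum_range_inv_smul_sub hm]
    abel
  simp only [heq]
  refine hmain.trans_eq ?_
  congr 3
  field_simp

/-- The expected soft maximum of the error of the estimate. -/
lemma lintegral_softmax_error_le [NeZero d] (hF : IsAdmissible P X F)
    (hσ : BoundedVariance P X F σ) (hL : 0 < L) (hsm : MeanSquaredSmooth P X F L) (hε : 0 < ε)
    (hm₁ : m₁ ≠ 0) (hm : m ≠ 0) (hs : IsSampling P μ K (x 1) ζ Y)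
    (hrun : ∀ s, IsRun X F η (ε / L) q m₁ m K (fun k i => ζ k i s) (fun k => x k s))
    {β : ℝ} (hβ : 0 < β) (n : ℕ) (hn : n + 1 ≤ K) :
    ∫⁻ s, ENNReal.ofReal (softmax β
      (spiderEstimate F q m₁ m (fun k => x k s) (fun k i => ζ k i s) (n + 1) -
        gradient (objective P F) (x (n + 1) s))) ∂μ ≤
      ENNReal.ofReal (Real.log d / β +
        β / 2 * (σ ^ 2 / m₁ + ((n % q : ℕ) : ℝ) * (4 * ε ^ 2 / m))) := by
  have hψ : 0 < ε / L := div_pos hε hL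
  induction n with
  | zero =>
    simpa using lintegral_softmax_error_le_of_mod_eq_zero hF hσ hψ hm₁ hs hrun hβ hn
      (Nat.zero_mod q)
  | succ n ih =>
    by_cases hnq : (n + 1) % q = 0
    · rw [hnq, Nat.cast_zero, zero_mul, add_zero]
      exact lintegral_softmax_error_le_of_mod_eq_zero hF hσ hψ hm₁ hs hrun hβ hn hnq
    · refine (lintegral_softmax_error_le_of_mod_ne_zero hF hL hsm hε hm hs hrun hβ (by omega) hn
        hnq).trans ((add_le_add_left (ih (by omega)) _).trans_eq ?_)
      have hlog := div_nonneg (Real.log_natCast_nonneg d) hβ.le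
      rw [← ENNReal.ofReal_add (by positivity) (by positivity), succ_mod_of_ne_zero hnq]
      congr 1
      push_cast
      ring

end Error

/-! ### The random output -/

section Output

/-- The expectation of a random element of a finite family, with a uniform random index that is
independent of the family. -/
lemma lintegral_uniform_index {S : Type*} {m mS : MeasurableSpace S} {μ : Measure S}
    [IsProbabilityMeasure μ] {K : ℕ} (hK : 1 ≤ K) {Y : S → ℕ} (hY : Measurable Y)
    (hunif : ∀ k ∈ Finset.Icc 1 K, μ {s | Y s = k} = (K : ℝ≥0∞)⁻¹)
    (hm : m ≤ mS) (hind : Indep (MeasurableSpace.comap Y inferInstance) m μ)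
    {R : ℕ → S → ℝ≥0∞} (hR : ∀ k ∈ Finset.Icc 1 K, Measurable[m] (R k)) :
    AEMeasurable (fun s => R (Y s) s) μ ∧
      ∫⁻ s, R (Y s) s ∂μ = (K : ℝ≥0∞)⁻¹ * ∑ k ∈ Finset.Icc 1 K, ∫⁻ s, R k s ∂μ := by
  have hYk : ∀ k, MeasurableSet[MeasurableSpace.comap Y inferInstance] {s | Y s = k} :=
    fun k => ⟨{k}, MeasurableSet.singleton k, rfl⟩
  have hYk' : ∀ k, MeasurableSet {s | Y s = k} := fun k => hY.comap_le _ (hYk k)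
  -- The K prescribed masses 1/K already sum to 1.
  have hmem : ∀ᵐ s ∂μ, Y s ∈ Finset.Icc 1 K := by
    have hset : {s | Y s ∈ Finset.Icc 1 K} = ⋃ k ∈ Finset.Icc 1 K, {s | Y s = k} := by
      ext s
      simp
    have h1 : μ {s | Y s ∈ Finset.Icc 1 K} = 1 := by
      rw [hset, measure_biUnion_finset (f := fun k => {s | Y s = k}) (fun i _ j _ hij => Set.disjoint_left.2
        fun s (hs : Y s = i) (hs' : Y s = j) => hij (hs.symm.trans hs')) fun k _ => hYk' k,
        Finset.sum_congr rfl hunif, Finset.sum_const, Nat.card_Icc, nsmul_eq_mul,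
        Nat.add_sub_cancel]
      exact ENNReal.mul_inv_cancel (by exact_mod_cast (by omega : K ≠ 0)) (ENNReal.natCast_ne_top K)
    have h2 : MeasurableSet {s | Y s ∈ Finset.Icc 1 K} := by
      rw [hset]
      exact Finset.measurableSet_biUnion _ fun k _ => hYk' k
    exact (mem_ae_iff_prob_eq_one h2).2 h1
  have heq : (fun s => R (Y s) s) =ᵐ[μ] fun s =>
      ∑ k ∈ Finset.Icc 1 K, {s | Y s = k}.indicator 1 s * R k s := by
    filter_upwards [hmem] with s hs
    rw [Finset.sum_eq_single_of_mem (Y s) hs]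
    · simp
    · intro k _ hk
      simp [Ne.symm hk]
  have hterm : ∀ k ∈ Finset.Icc 1 K,
      Measurable fun s => ({s | Y s = k}.indicator 1 s * R k s : ℝ≥0∞) := fun k hk =>
    (measurable_one.indicator (hYk' k)).mul ((hR k hk).mono hm le_rfl)
  have hone : ∀ k, Measurable[MeasurableSpace.comap Y inferInstance]
      fun s => ({s | Y s = k}.indicator 1 s : ℝ≥0∞) := fun k =>
    (Measurable.of_discrete (f := ({k} : Set ℕ).indicator (1 : ℕ → ℝ≥0∞))).comp
      (comap_measurable Y)
  refine ⟨⟨_, Finset.measurable_fun_sum _ hterm, heq⟩, ?_⟩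
  rw [lintegral_congr_ae heq, lintegral_finsetSum _ hterm, Finset.mul_sum]
  refine Finset.sum_congr rfl fun k hk => ?_
  rw [lintegral_mul_eq_lintegral_mul_lintegral_of_independent_measurableSpace hY.comap_le hm hind
    (hone k) (hR k hk), lintegral_indicator_one (hYk' k), hunif k hk]

end Output

/-! ### The parameters -/

section Parameters

lemma three_le_exp_two : (3 : ℝ) ≤ Real.exp 2 := by
  have := Real.add_one_le_exp (2 : ℝ)
  linarith

lemma half_lt_log_natCast {d : ℕ} (hd : 2 ≤ d) : (1 / 2 : ℝ) < Real.log d := by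
  have h1 : Real.log 2 ≤ Real.log d :=
    Real.log_le_log (by norm_num) (by exact_mod_cast hd)
  linarith [Real.log_two_gt_d9]

lemma one_le_Omega {d : ℕ} (hd : 2 ≤ d) : 1 ≤ Omega d := by
  have := half_lt_log_natCast hd
  have := three_le_exp_two
  unfold Omega
  nlinarith

/-- With the batch sizes of the method, the expected error is at most `3 ε`. -/
lemma error_bound_le {d : ℕ} (hd : 2 ≤ d) {c σ ε qr mr : ℝ} {m₁ m q r : ℕ}
    (hc : Real.exp 2 ≤ c) (hε : 0 < ε) (hσ : 0 < σ)
    (hm₁ : Omega d * c * Real.log d * σ ^ 2 / ε ^ 2 ≤ m₁) (hmr : mr = Omega d ^ 2 * qr)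
    (hq : IsRounding qr q) (hm : IsRounding mr m) (hr : r < q) :
    Real.log d / (Real.log d / ε) + (Real.log d / ε) / 2 *
      (σ ^ 2 / m₁ + (r : ℝ) * (4 * ε ^ 2 / m)) + Real.log 2 / (Real.log d / ε) ≤ 3 * ε := by
  have hl2 : Real.log 2 ≤ Real.log d :=
    Real.log_le_log (by norm_num) (by exact_mod_cast hd)
  have hl3 := Real.log_two_gt_d9
  have hE := three_le_exp_two
  have hΩ : Omega d = Real.exp 2 * Real.log d := rfl
  set l := Real.log d with hl
  set Ω := Omega d
  have hl0 : 0 < l := by linarith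
  have hΩ3 : 3 * l ≤ Ω := by rw [hΩ]; nlinarith
  have hcl : 3 * l ≤ c * l := by nlinarith
  have hc0 : 0 < c := by linarith
  have hΩ0 : 0 < Ω := by linarith
  -- The bound e² ≥ 3 is used twice, through Ω and through c ≥ e².
  have h9 : 9 * l ^ 2 ≤ Ω * c * l := by nlinarith
  have hm₁0 : (0 : ℝ) < m₁ := lt_of_lt_of_le (by positivity) hm₁
  have h1 : σ ^ 2 / m₁ ≤ ε ^ 2 / (9 * l ^ 2) := by
    rw [div_le_div_iff₀ hm₁0 (by positivity)]
    rw [div_le_iff₀ (by positivity)] at hm₁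
    nlinarith [sq_nonneg σ]
  have hm1 : (1 : ℝ) ≤ m := by exact_mod_cast hm.1
  have h2 : (r : ℝ) * (4 * ε ^ 2 / m) ≤ 8 * (ε ^ 2 / (9 * l ^ 2)) := by
    have hrq : (r : ℝ) + 1 ≤ q := by exact_mod_cast hr
    -- Rounding costs nothing for q, as r + 1 ≤ q < qr + 1, and a factor 2 for m, as mr < m + 1 ≤
    -- 2m.
    have hrqr : (r : ℝ) ≤ qr := by linarith [(abs_lt.1 hq.2).2]
    have hmr2 : mr ≤ 2 * m := by linarith [(abs_lt.1 hm.2).1]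
    have h3 : (r : ℝ) * (9 * l ^ 2) ≤ 2 * m := by
      have : 9 * l ^ 2 ≤ Ω ^ 2 := by nlinarith
      calc (r : ℝ) * (9 * l ^ 2) ≤ qr * Ω ^ 2 :=
            mul_le_mul hrqr this (by positivity) ((Nat.cast_nonneg r).trans hrqr)
        _ = mr := by rw [hmr, mul_comm]
        _ ≤ _ := hmr2
    rw [mul_div_assoc', mul_div_assoc', div_le_div_iff₀ (by linarith) (by positivity)]
    nlinarith [sq_nonneg ε]
  have h4 : l / ε / 2 * (σ ^ 2 / m₁ + (r : ℝ) * (4 * ε ^ 2 / m)) ≤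
      l / ε / 2 * (9 * (ε ^ 2 / (9 * l ^ 2))) :=
    mul_le_mul_of_nonneg_left (by linarith) (by positivity)
  have h5 : l / ε / 2 * (9 * (ε ^ 2 / (9 * l ^ 2))) = ε * (1 / (2 * l)) := by field_simp
  -- Here d ≥ 2 enters through log d > 1/2.
  have h6 : 1 / (2 * l) ≤ 1 := by
    rw [div_le_one (by positivity)]
    linarith
  have h7 : l / (l / ε) = ε := by field_simp
  have h8 : Real.log 2 / (l / ε) ≤ ε := by
    rw [div_le_iff₀ (by positivity), mul_div_cancel₀ _ hε.ne']
    exact hl2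
  have h10 := mul_le_mul_of_nonneg_left h6 hε.le
  linarith

/-- There are ⌈K/q⌉ large batches; a new one starts exactly when q divides the number of iterations
already done. -/
lemma sampleCount_le {q : ℕ} (hq : 1 ≤ q) (m₁ m K : ℕ) :
    sampleCount q m₁ m K ≤ (K + q - 1) / q * m₁ + K * m := by
  induction K with
  | zero => simp [sampleCount]
  | succ K ih =>
    have hsum : sampleCount q m₁ m (K + 1) = sampleCount q m₁ m K + batchSize q m₁ m (K + 1) := by
      rw [sampleCount, Finset.sum_Icc_succ_top (by omega)]
      rfl
    rw [hsum, batchSize]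
    simp only [refreshIndex_succ_eq_iff]
    split_ifs with h
    · obtain ⟨t, rfl⟩ := Nat.dvd_of_mod_eq_zero h
      have h1 : (q * t + q - 1) / q = t := by
        rw [Nat.add_sub_assoc hq, Nat.mul_add_div hq, Nat.div_eq_of_lt (by omega), add_zero]
      have h2 : (q * t + 1 + q - 1) / q = t + 1 := by
        rw [show q * t + 1 + q - 1 = q * (t + 1) by rw [mul_add]; omega,
          Nat.mul_div_cancel_left _ hq]
      rw [h1] at ih
      rw [h2]
      nlinarith
    · have h1 : (K + q - 1) / q * m₁ ≤ (K + 1 + q - 1) / q * m₁ :=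
        Nat.mul_le_mul_right _ (Nat.div_le_div_right (by omega))
      nlinarith

/-- The number of samples drawn by the method. -/
lemma sampleCount_le_of_parameters {d : ℕ} (hd : 2 ≤ d) {c σ ε T qr mr : ℝ} {m₁ m q K : ℕ}
    (hc : Real.exp 2 ≤ c) (hε : 0 < ε) (hσ : 0 < σ)
    (hK : (K : ℝ) ≤ T / ε ^ 2 + 1) (hm₁1 : 1 ≤ m₁)
    (hm₁ : (m₁ : ℝ) ≤ Omega d * c * Real.log d * σ ^ 2 / ε ^ 2 + 1) (hqr : 0 < qr)
    (hmr : mr = Omega d ^ 2 * qr) (hprod : mr * qr = m₁)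
    (hq : IsRounding qr q) (hm : IsRounding mr m)
    (h1 : ε ≤ Omega d * σ) (h2 : ε ^ 2 ≤ T) (h3 : ε * σ ≤ T) :
    (sampleCount q m₁ m K : ℝ) ≤ 9 * (c + 1) * (T * Omega d ^ 2 * σ / ε ^ 3) := by
  have hE := three_le_exp_two
  have hΩ1 := one_le_Omega hd
  have hΩ : Omega d = Real.exp 2 * Real.log d := rfl
  have hl := half_lt_log_natCast hd
  have hc0 : 0 < c := by linarith
  have hT0 : 0 < T := lt_of_lt_of_le (by positivity) h2
  set l := Real.log d
  set Ω := Omega d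
  have hm₁1' : (1 : ℝ) ≤ m₁ := by exact_mod_cast hm₁1
  have hq1 : (1 : ℝ) ≤ q := by exact_mod_cast hq.1
  have hmr0 : 0 < mr := by rw [hmr]; positivity
  -- With A ≥ 1, the +1 from rounding m₁ up is absorbed into (c + 1)A².
  have hA : 1 ≤ Ω * σ / ε := by rwa [one_le_div hε]
  set A := Ω * σ / ε with hA_def
  have hm₁A : (m₁ : ℝ) ≤ (c + 1) * A ^ 2 := by
    have h4 : Ω * c * l * σ ^ 2 / ε ^ 2 ≤ c * A ^ 2 := by
      have : l ≤ Ω := by rw [hΩ]; nlinarith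
      calc Ω * c * l * σ ^ 2 / ε ^ 2 ≤ Ω * c * Ω * σ ^ 2 / ε ^ 2 := by
            have : 0 ≤ c := by linarith
            gcongr
        _ = c * A ^ 2 := by rw [hA_def]; ring
    nlinarith
  -- Eliminating qr shows that mr is Ω √m₁, hence of order Ω A.
  have hmrsq : mr ^ 2 = Ω ^ 2 * m₁ := by rw [← hprod, hmr]; ring
  have hmrA : mr ≤ Ω * (c + 1) * A := by
    refine (sq_le_sq₀ hmr0.le (by positivity)).1 ?_
    rw [hmrsq]
    calc Ω ^ 2 * (m₁ : ℝ) ≤ Ω ^ 2 * ((c + 1) * A ^ 2) := by gcongr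
      _ ≤ Ω ^ 2 * ((c + 1) ^ 2 * A ^ 2) := by
          gcongr
          nlinarith
      _ = _ := by ring
  have hmr1 : 1 ≤ mr := by
    refine (sq_le_sq₀ zero_le_one hmr0.le).1 ?_
    rw [hmrsq]
    nlinarith
  have hm2 : (m : ℝ) ≤ 2 * mr := by linarith [(abs_lt.1 hm.2).2]
  have hm₁q : (m₁ : ℝ) ≤ 2 * mr * q := by
    have : qr ≤ 2 * q := by linarith [(abs_lt.1 hq.2).1]
    rw [← hprod]
    nlinarith
  have hcount : (sampleCount q m₁ m K : ℝ) ≤ ((K : ℝ) / q + 1) * m₁ + K * m := by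
    have h4 : (sampleCount q m₁ m K : ℝ) ≤ (((K + q - 1) / q : ℕ) : ℝ) * m₁ + K * m := by
      exact_mod_cast sampleCount_le hq.1 m₁ m K
    refine h4.trans ?_
    gcongr
    refine Nat.cast_div_le.trans ?_
    rw [div_add_one (by positivity)]
    gcongr
    have : K + q - 1 ≤ K + q := by omega
    exact_mod_cast this
  have hK2 : (K : ℝ) ≤ 2 * T / ε ^ 2 := by
    have : 1 ≤ T / ε ^ 2 := by rwa [one_le_div (by positivity)]
    rw [mul_div_assoc]
    linarith
  have h4 : (K : ℝ) / q * m₁ ≤ K * (2 * mr) := by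
    rw [div_mul_eq_mul_div, div_le_iff₀ (by positivity), mul_assoc]
    gcongr
  have h5 : (K : ℝ) * m ≤ K * (2 * mr) := by gcongr
  have h6 : (K : ℝ) * (2 * mr) ≤ 4 * (c + 1) * (T * Ω ^ 2 * σ / ε ^ 3) := by
    calc (K : ℝ) * (2 * mr) ≤ 2 * T / ε ^ 2 * (2 * (Ω * (c + 1) * A)) := by
          gcongr
      _ = _ := by rw [hA_def]; field_simp; ring
  -- This pays for the possibly incomplete last epoch, and is the only place where εσ ≤ T is needed.
  -- The total constant is 4 + 4 + 1 = 9.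
  have h7 : (m₁ : ℝ) ≤ (c + 1) * (T * Ω ^ 2 * σ / ε ^ 3) := by
    refine hm₁A.trans ?_
    have h8 : A ^ 2 ≤ T * Ω ^ 2 * σ / ε ^ 3 := by
      calc A ^ 2 = (ε * σ) * Ω ^ 2 * σ / ε ^ 3 := by rw [hA_def]; field_simp
        _ ≤ _ := by gcongr
    gcongr
  linarith

end Parameters

/-! ### The expected residual -/

section ExpectedResidual

variable {Ξ : Type*} {X : Set (Vec d)} {F : Vec d → Ξ → ℝ} {ε σ L fLow Δf : ℝ} {q m₁ m K : ℕ}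
  [MeasurableSpace Ξ] {P : Measure Ξ} [IsProbabilityMeasure P] {S : Type*} {mS : MeasurableSpace S}
  {μ : Measure S} [IsProbabilityMeasure μ] {x : ℕ → S → Vec d} {ζ : ℕ → ℕ → S → Ξ} {Y : S → ℕ}

/-- The expected error of the estimate of the gradient. -/
lemma lintegral_linfNorm_error_le (hd : 2 ≤ d) (hF : IsAdmissible P X F) (hσ0 : 0 < σ)
    (hσ : BoundedVariance P X F σ) (hL : 0 < L) (hsm : MeanSquaredSmooth P X F L) (hε : 0 < ε)
    {c qr mr : ℝ} (hc : Real.exp 2 ≤ c) (hm₁0 : m₁ ≠ 0)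
    (hm₁ : Omega d * c * Real.log d * σ ^ 2 / ε ^ 2 ≤ m₁) (hmr : mr = Omega d ^ 2 * qr)
    (hq : IsRounding qr q) (hm : IsRounding mr m) (hs : IsSampling P μ K (x 1) ζ Y)
    (hrun : ∀ s, IsRun X F (1 / L) (ε / L) q m₁ m K (fun k i => ζ k i s) (fun k => x k s))
    {k : ℕ} (hk : k ∈ Finset.Icc 1 K) :
    ∫⁻ s, ENNReal.ofReal (linfNorm
      (spiderEstimate F q m₁ m (fun k => x k s) (fun k i => ζ k i s) k -
        gradient (objective P F) (x k s))) ∂μ ≤ ENNReal.ofReal (3 * ε) := by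
  have : NeZero d := ⟨by omega⟩
  obtain ⟨hk1, hkK⟩ := Finset.mem_Icc.1 hk
  obtain ⟨n, rfl⟩ : ∃ n, k = n + 1 := ⟨k - 1, by omega⟩
  have hlog : 0 < Real.log d := by linarith [half_lt_log_natCast hd]
  -- With β = log d/ε the soft maximum starts at log d/β = ε.
  have hβ : 0 < Real.log d / ε := div_pos hlog hε
  have hlog2 : 0 ≤ Real.log 2 / (Real.log d / ε) :=
    div_nonneg (Real.log_nonneg (by norm_num)) hβ.le
  have hm0 : m ≠ 0 := by have := hm.1; omega
  refine (lintegral_mono fun s => ((ENNReal.ofReal_le_ofReal (linfNorm_le_softmax hβ _)).trans_eq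
    (ENNReal.ofReal_add (softmax_nonneg hβ _) hlog2))).trans ?_
  rw [lintegral_add_right _ measurable_const, lintegral_const, measure_univ, mul_one]
  refine (add_le_add_left (lintegral_softmax_error_le hF hσ hL hsm hε hm₁0 hm0 hs hrun hβ n hkK)
    _).trans ?_
  rw [← ENNReal.ofReal_add (by positivity) hlog2]
  exact ENNReal.ofReal_le_ofReal
    (error_bound_le hd hc hε hσ0 hm₁ hmr hq hm (Nat.mod_lt _ (by have := hq.1; omega)))

/-- The sum of the expected residuals along the iterates. -/
lemma sum_lintegral_residual_le (hF : IsAdmissible P X F) (hL : 0 < L)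
    (hsm : MeanSquaredSmooth P X F L) (hε : 0 < ε) (hlow : ∀ x ∈ X, fLow ≤ objective P F x)
    (hs : IsSampling P μ K (x 1) ζ Y)
    (hrun : ∀ s, IsRun X F (1 / L) (ε / L) q m₁ m K (fun k i => ζ k i s) (fun k => x k s))
    (hint : Integrable (fun s => objective P F (x 1 s)) μ)
    (hΔ : Δf = (∫ s, objective P F (x 1 s) ∂μ) - fLow)
    (herr : ∀ k ∈ Finset.Icc 1 K, ∫⁻ s, ENNReal.ofReal (linfNorm
      (spiderEstimate F q m₁ m (fun k => x k s) (fun k i => ζ k i s) k -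
        gradient (objective P F) (x k s))) ∂μ ≤ ENNReal.ofReal (3 * ε)) :
    ∑ k ∈ Finset.Icc 1 K, ∫⁻ s, residual (objective P F) X (x (k + 1) s) ∂μ ≤
      ENNReal.ofReal (9 * ε * K + L / ε * Δf) := by
  have hψ : 0 < ε / L := div_pos hε hL
  have hg := hF.linfNorm_gradient_sub_le hL.le hsm
  have hmeas := measurable_iterates hF hψ hrun
  set f := objective P F with hf
  set e : ℕ → S → ℝ := fun k s => linfNorm
    (spiderEstimate F q m₁ m (fun k => x k s) (fun k i => ζ k i s) k - gradient f (x k s)) with he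
  have he0 : ∀ k s, 0 ≤ e k s := fun k s => linfNorm_nonneg _
  have hx : ∀ k ∈ Finset.Icc 1 K, Measurable (x (k + 1)) := fun k hk =>
    (hmeas k (Finset.mem_Icc.1 hk).2).1.mono (hs.history_le _) le_rfl
  have hem : ∀ k ∈ Finset.Icc 1 K, Measurable (e k) := fun k hk => by
    obtain ⟨-, h2, h3⟩ := hmeas k (Finset.mem_Icc.1 hk).2
    exact continuous_linfNorm.measurable.comp ((h2.mono (hs.history_le _) le_rfl).sub
      ((measurable_gradient f).comp
        ((h3 (Finset.mem_Icc.1 hk).1).mono (hs.history_le _) le_rfl)))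
  have hres : Measurable (residual f X) := measurable_residual hF.isClosed hF.convex
    hF.differentiable_objective (hF.continuousOn_gradient hL.le hsm)
  have hstep : ∀ s, ∀ k ∈ Finset.Icc 1 K,
      0 ≤ 3 * ε + 2 * e k s + L / ε * (f (x k s) - f (x (k + 1) s)) ∧
      residual f X (x (k + 1) s) ≤
        ENNReal.ofReal (3 * ε + 2 * e k s + L / ε * (f (x k s) - f (x (k + 1) s))) := by
    intro s k hk
    obtain ⟨hk1, hkK⟩ := Finset.mem_Icc.1 hk
    exact residual_proxProj_le hF.convex hF.differentiable_objective hL hg hε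
      ((hrun s).mem hk1 (by omega)) ((hrun s).step k hk1 hkK)
  have htel : ∀ s, ∑ k ∈ Finset.Icc 1 K, (f (x k s) - f (x (k + 1) s)) =
      f (x 1 s) - f (x (K + 1) s) := by
    intro s
    have h := Finset.sum_range_sub' (fun k => f (x (k + 1) s)) K
    rw [zero_add] at h
    rw [← h, Finset.range_eq_Ico, Finset.sum_Ico_add' (fun k => f (x k s) - f (x (k + 1) s)) 0 K 1]
    rfl
  have hlow1 : ∀ s, 0 ≤ f (x 1 s) - fLow := fun s => sub_nonneg.2 (hlow _ (hrun s).init_mem)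
  -- Telescoping takes place pointwise, before integration, so only f(x¹) has to be integrable.
  have hpt : ∀ s, ∑ k ∈ Finset.Icc 1 K, residual f X (x (k + 1) s) ≤
      ENNReal.ofReal (3 * ε * K) + ∑ k ∈ Finset.Icc 1 K, 2 * ENNReal.ofReal (e k s) +
        ENNReal.ofReal (L / ε * (f (x 1 s) - fLow)) := by
    intro s
    refine (Finset.sum_le_sum fun k hk => (hstep s k hk).2).trans ?_
    rw [← ENNReal.ofReal_sum_of_nonneg fun k hk => (hstep s k hk).1]
    have hsum : ∑ k ∈ Finset.Icc 1 K, 2 * ENNReal.ofReal (e k s) =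
        ENNReal.ofReal (∑ k ∈ Finset.Icc 1 K, 2 * e k s) := by
      rw [ENNReal.ofReal_sum_of_nonneg fun k _ => mul_nonneg zero_le_two (he0 k s)]
      refine Finset.sum_congr rfl fun k _ => ?_
      rw [ENNReal.ofReal_mul zero_le_two, ENNReal.ofReal_ofNat]
    have h0 : 0 ≤ ∑ k ∈ Finset.Icc 1 K, 2 * e k s :=
      Finset.sum_nonneg fun k _ => mul_nonneg zero_le_two (he0 k s)
    rw [hsum, ← ENNReal.ofReal_add (by positivity) h0, ← ENNReal.ofReal_add (by positivity)
      (mul_nonneg (by positivity) (hlow1 s))]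
    refine ENNReal.ofReal_le_ofReal ?_
    rw [Finset.sum_add_distrib, Finset.sum_add_distrib, ← Finset.mul_sum _ _ (L / ε), htel,
      Finset.sum_const, Nat.card_Icc, Nat.add_sub_cancel, nsmul_eq_mul]
    have h1 : L / ε * (f (x 1 s) - f (x (K + 1) s)) ≤ L / ε * (f (x 1 s) - fLow) :=
      mul_le_mul_of_nonneg_left
        (sub_le_sub_left (hlow _ ((hrun s).mem (k := K + 1) (by omega) le_rfl)) _) (by positivity)
    linarith
  have hterm : ∀ k ∈ Finset.Icc 1 K, Measurable fun s => 2 * ENNReal.ofReal (e k s) :=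
    fun k hk => (ENNReal.measurable_ofReal.comp (hem k hk)).const_mul 2
  rw [← lintegral_finsetSum (f := fun k s => residual f X (x (k + 1) s)) _
    fun k hk => hres.comp (hx k hk)]
  refine (lintegral_mono hpt).trans ?_
  have hsum_meas : Measurable fun s => ENNReal.ofReal (3 * ε * K) +
      ∑ k ∈ Finset.Icc 1 K, 2 * ENNReal.ofReal (e k s) :=
    measurable_const.add (Finset.measurable_fun_sum _ hterm)
  rw [lintegral_add_left hsum_meas, lintegral_add_left measurable_const, lintegral_const, measure_univ, mul_one,
    lintegral_finsetSum _ hterm]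
  have h2 : ∑ k ∈ Finset.Icc 1 K, ∫⁻ s, 2 * ENNReal.ofReal (e k s) ∂μ ≤
      ENNReal.ofReal (6 * ε * K) := by
    calc ∑ k ∈ Finset.Icc 1 K, ∫⁻ s, 2 * ENNReal.ofReal (e k s) ∂μ
        ≤ ∑ k ∈ Finset.Icc 1 K, ENNReal.ofReal (6 * ε) := by
          refine Finset.sum_le_sum fun k hk => ?_
          rw [lintegral_const_mul 2 (f := fun s => ENNReal.ofReal (e k s))
            (ENNReal.measurable_ofReal.comp (hem k hk))]
          refine (mul_le_mul_right (herr k hk) 2).trans_eq ?_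
          rw [← ENNReal.ofReal_ofNat 2, ← ENNReal.ofReal_mul zero_le_two]
          congr 1
          ring
      _ = _ := by
          rw [Finset.sum_const, Nat.card_Icc, Nat.add_sub_cancel, nsmul_eq_mul,
            ENNReal.ofReal_mul (p := 6 * ε) (by positivity), ENNReal.ofReal_natCast, mul_comm]
  have hint' : Integrable (fun s => L / ε * (f (x 1 s) - fLow)) μ :=
    (hint.sub (integrable_const _)).const_mul _
  have h3 : ∫⁻ s, ENNReal.ofReal (L / ε * (f (x 1 s) - fLow)) ∂μ =
      ENNReal.ofReal (L / ε * Δf) := by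
    rw [← ofReal_integral_eq_lintegral_ofReal hint' (Filter.Eventually.of_forall fun s =>
      mul_nonneg (by positivity) (hlow1 s)), integral_const_mul,
      integral_sub hint (integrable_const _), integral_const, probReal_univ, one_smul, hΔ]
  have hΔ0 : 0 ≤ Δf := by
    have : 0 ≤ ∫ s, (f (x 1 s) - fLow) ∂μ := integral_nonneg fun s => hlow1 s
    rwa [integral_sub hint (integrable_const _), integral_const, probReal_univ, one_smul,
      ← hΔ] at this
  rw [h3]
  refine (add_le_add_left (add_le_add_right h2 _) _).trans_eq ?_
  rw [← ENNReal.ofReal_add (by positivity) (by positivity),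
    ← ENNReal.ofReal_add (by positivity) (by positivity)]
  congr 1
  ring

/-- The expected residual of the random output. -/
lemma lintegral_residual_output_le (hF : IsAdmissible P X F) (hL : 0 < L)
    (hsm : MeanSquaredSmooth P X F L) (hε : 0 < ε) (hlow : ∀ x ∈ X, fLow ≤ objective P F x)
    (hK1 : 1 ≤ K) (hK : Δf * L / ε ^ 2 ≤ K) (hs : IsSampling P μ K (x 1) ζ Y)
    (hrun : ∀ s, IsRun X F (1 / L) (ε / L) q m₁ m K (fun k i => ζ k i s) (fun k => x k s))
    (hint : Integrable (fun s => objective P F (x 1 s)) μ)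
    (hΔ : Δf = (∫ s, objective P F (x 1 s) ∂μ) - fLow)
    (herr : ∀ k ∈ Finset.Icc 1 K, ∫⁻ s, ENNReal.ofReal (linfNorm
      (spiderEstimate F q m₁ m (fun k => x k s) (fun k i => ζ k i s) k -
        gradient (objective P F) (x k s))) ∂μ ≤ ENNReal.ofReal (3 * ε)) :
    AEMeasurable (fun s => residual (objective P F) X (x (Y s + 1) s)) μ ∧
      ∫⁻ s, residual (objective P F) X (x (Y s + 1) s) ∂μ ≤ ENNReal.ofReal (10 * ε) := by
  have hmeas := measurable_iterates hF (div_pos hε hL) hrun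
  have hres : Measurable (residual (objective P F) X) := measurable_residual hF.isClosed hF.convex
    hF.differentiable_objective (hF.continuousOn_gradient hL.le hsm)
  have hpast : Measurable fun s => (x 1 s, fun k i => ζ k i s) :=
    hs.measurable_init.prodMk (measurable_pi_lambda _ fun k => measurable_pi_lambda _ fun i =>
      hs.measurable_sample k i)
  -- Every residual is measurable with respect to the starting point and the samples, and Y is
  -- independent of these; the expectation is thus the average over the iterates.
  obtain ⟨h1, h2⟩ := lintegral_uniform_index hK1 hs.measurable_index hs.uniform_index
    hpast.comap_le hs.indep_index (R := fun k s => residual (objective P F) X (x (k + 1) s))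
    fun k hk => hres.comp ((hmeas k (Finset.mem_Icc.1 hk).2).1.mono history_le_comap le_rfl)
  refine ⟨h1, ?_⟩
  have hK0 : (0 : ℝ) < K := by exact_mod_cast hK1
  have hle : 9 * ε * K + L / ε * Δf ≤ K * (10 * ε) := by
    rw [div_le_iff₀ (by positivity)] at hK
    have : L / ε * Δf ≤ K * ε := by
      rw [div_mul_eq_mul_div, div_le_iff₀ hε]
      linarith
    linarith
  rw [h2]
  refine (mul_le_mul_right ((sum_lintegral_residual_le hF hL hsm hε hlow hs hrun hint hΔ
    herr).trans (ENNReal.ofReal_le_ofReal hle)) _).trans_eq ?_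
  rw [ENNReal.ofReal_mul hK0.le, ENNReal.ofReal_natCast, ← mul_assoc,
    ENNReal.inv_mul_cancel (by exact_mod_cast hK0.ne') (ENNReal.natCast_ne_top K), one_mul]

end ExpectedResidual

end DISFOM

theorem corollary4 :
    ∃ C : ℝ, 0 < C ∧ ∀ c : ℝ, Real.exp 2 ≤ c → ∃ C' : ℝ, 0 < C' ∧
      ∀ (d : ℕ), 2 ≤ d →
      ∀ (Ξ : Type*) [MeasurableSpace Ξ] (P : Measure Ξ) [IsProbabilityMeasure P]
        (X : Set (DISFOM.Vec d)) (F : DISFOM.Vec d → Ξ → ℝ) (σ L fLow : ℝ),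
      -- the problem and its assumptions
      DISFOM.IsAdmissible P X F →
      0 < σ → DISFOM.BoundedVariance P X F σ →
      0 < L → DISFOM.MeanSquaredSmooth P X F L →
      (∀ x ∈ X, fLow ≤ DISFOM.objective P F x) →
      -- the parameters; `qr`, `mr` are the real numbers that `q`, `m` are rounded from
      ∀ (ε Δf η ψ qr mr : ℝ) (K m₁ m q : ℕ),
      0 < ε → 0 < Δf →
      η = 1 / L →
      ψ = ε / L →
      K = ⌈Δf * L / ε ^ 2⌉₊ →
      m₁ = ⌈DISFOM.Omega d * c * Real.log d * σ ^ 2 / ε ^ 2⌉₊ →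
      0 < qr → mr = DISFOM.Omega d ^ 2 * qr → mr * qr = m₁ →
      DISFOM.IsRounding qr q → DISFOM.IsRounding mr m →
      -- the expected residual of the random output
      (∀ (S : Type*) [MeasurableSpace S] (μ : Measure S) [IsProbabilityMeasure μ]
          (x : ℕ → S → DISFOM.Vec d) (ζ : ℕ → ℕ → S → Ξ) (Y : S → ℕ),
        DISFOM.IsSampling P μ K (x 1) ζ Y →
        (∀ s, DISFOM.IsRun X F η ψ q m₁ m K (fun k i => ζ k i s) (fun k => x k s)) →
        Integrable (fun s => DISFOM.objective P F (x 1 s)) μ →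
        Δf = (∫ s, DISFOM.objective P F (x 1 s) ∂μ) - fLow →
        AEMeasurable (fun s => DISFOM.residual (DISFOM.objective P F) X (x (Y s + 1) s)) μ ∧
        ∫⁻ s, DISFOM.residual (DISFOM.objective P F) X (x (Y s + 1) s) ∂μ
          ≤ ENNReal.ofReal (C * ε)) ∧
      -- the sample complexity
      (ε ≤ DISFOM.Omega d * σ → ε ^ 2 ≤ Δf * L → ε * σ ≤ Δf * L →
        (DISFOM.sampleCount q m₁ m K : ℝ)
          ≤ C' * (Δf * L * DISFOM.Omega d ^ 2 * σ / ε ^ 3)) := by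
  refine ⟨10, by norm_num, fun c hc => ?_⟩
  have hE := DISFOM.three_le_exp_two
  refine ⟨9 * (c + 1), by linarith, ?_⟩
  intro d hd Ξ _ P _ X F σ L fLow hF hσ0 hσ hL hsm hlow ε Δf η ψ qr mr K m₁ m q hε hΔ hη hψ hK hm₁
    hqr hmr hprod hq hm
  subst hη hψ
  have hlog := DISFOM.half_lt_log_natCast hd
  have hΩ := DISFOM.one_le_Omega hd
  have hpos : 0 < DISFOM.Omega d * c * Real.log d * σ ^ 2 / ε ^ 2 := by
    have : 0 < c := by linarith
    have : 0 < Real.log d := by linarith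
    positivity
  have hm₁1 : 1 ≤ m₁ := by
    rw [hm₁]
    exact Nat.ceil_pos.2 hpos
  have hKpos : 0 < Δf * L / ε ^ 2 := by positivity
  have hK1 : 1 ≤ K := by
    rw [hK]
    exact Nat.ceil_pos.2 hKpos
  have hKle : Δf * L / ε ^ 2 ≤ K := by
    rw [hK]
    exact Nat.le_ceil _
  have hm₁le : DISFOM.Omega d * c * Real.log d * σ ^ 2 / ε ^ 2 ≤ m₁ := by
    rw [hm₁]
    exact Nat.le_ceil _
  refine ⟨fun S _ μ _ x ζ Y hs hrun hint hΔf => ?_, fun h1 h2 h3 => ?_⟩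
  · exact DISFOM.lintegral_residual_output_le hF hL hsm hε hlow hK1 hKle hs hrun hint hΔf
      fun k hk => DISFOM.lintegral_linfNorm_error_le hd hF hσ0 hσ hL hsm hε hc (by omega) hm₁le hmr
        hq hm hs hrun hk
  · refine DISFOM.sampleCount_le_of_parameters hd hc hε hσ0 ?_ hm₁1 ?_ hqr hmr hprod hq hm h1 h2 h3
    · rw [hK]
      exact (Nat.ceil_lt_add_one hKpos.le).le
    · rw [hm₁]
      exact (Nat.ceil_lt_add_one hpos.le).le
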